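/- Let $K$ be a field (for instance $K=\mathbb{C}$ or $K=\mathbb{C}(q^{1/2},t^{1/2})$) and let $q,t\in K^\times$ have square roots $q^{1/2},t^{1/2}\in K$, which we fix. Assume that the only pair of integers $(a,b)$ with $q^at^b=1$ is $(0,0)$. **Macdonald polynomials.** Define linear operators on $K[X,X^{-1}]$ by $$T_\pi X^r=q^{r/2}X^{-r},\qquad T_1X^r=t^{1/2}X^{-r}+(t^{1/2}-t^{-1/2})\frac{X^r-X^{-r}}{1-X^2}\qquad(r\in\mathbb{Z}),\qquad Y=T_\pi T_1 .$$ For $r\in\mathbb{Z}$ the electronic Macdonald polynomial $E_r\in K[X,X^{-1}]$ of type $SL_2$ is the (unique) eigenvector of $Y$ with eigenvalue $t^{-1/2}q^{-r/2}$ if $r>0$ and $t^{1/2}q^{-r/2}$ if $r\le 0$, in which the coefficient of $X^r$ is $1$. For $m\in\mathbb{Z}_{\ge0}$ the bosonic Macdonald polynomial is $P_m=E_{-m}+\frac{t(1-q^m)}{1-tq^m}E_m$. **Coefficients.** Let $(z;q)_j=\prod_{i=0}^{j-1}(1-zq^i)$ and $$\genfrac[]{0pt}{0}{\ell}{j}_{q,t}=\frac{(q;q)_\ell/(t;q)_\ell}{\dfrac{(q;q)_j}{(t;q)_j}\cdot\dfrac{(q;q)_{\ell-j}}{(t;q)_{\ell-j}}}.$$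 In the field $K(Y)$ of rational functions in a variable $Y$ put, for $0\le j\le \ell$, $$C_j^{(\ell)}(Y)=\genfrac[]{0pt}{0}{\ell}{j}_{q,t}\frac{(t^{-1}Y^{-2}q^{-(j-1)};q)_j\,(tY^{-2}q^{\ell-2j};q)_j}{(Y^{-2}q^{\ell-2j+1};q)_j\,(Y^{-2}q^{-j};q)_j},$$ and for $0\le j\le \ell-1$ $$A_j^{(\ell)}(Y)=\genfrac[]{0pt}{0}{\ell}{j}_{q,t}\frac{1-q^{\ell-j}}{1-q^\ell}\cdot\frac{(t^{-1}Y^{-2}q^{-(j-1)};q)_j\,(tY^{-2}q^{\ell-2j};q)_j}{(Y^{-2}q^{-j};q)_j\,(Y^{-2}q^{\ell-2j};q)_j},$$ $$B_j^{(\ell)}(Y)=q^j\genfrac[]{0pt}{0}{\ell}{j}_{q,t}\frac{1-q^{\ell-j}}{1-q^\ell}\cdot\frac{(t^{-1}Y^{-2}q^{-(\ell-j-1)};q)_{\ell-j}\,(tY^{-2}q^{-(\ell-2j-1)};q)_{\ell-j-1}}{(Y^{-2}q^{-(\ell-2j-1)};q)_{\ell-j}\,(Y^{-2}q^{-(\ell-j-1)};q)_{\ell-j-1}}.$$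 Let $\mathrm{ev}_m$ be the evaluation $Y\mapsto t^{-1/2}q^{-m/2}$, defined on the elements of $K(Y)$ whose denominator (in lowest terms) does not evaluate to $0$. **Theorem.** Let $\ell,m\in\mathbb{Z}_{>0}$. Each $E_r$ ($r\in\mathbb{Z}$) exists and is unique, all evaluations below are defined, $\mathrm{ev}_m(C_j^{(\ell)}(Y))=0$ whenever $0\le j\le\ell$ and $m+\ell-2j<0$ (such terms are to be read as $0$), and $$P_\ell P_m=\sum_{j=0}^{\ell}\mathrm{ev}_m(C_j^{(\ell)}(Y))\,P_{m+\ell-2j},$$ $$E_\ell P_m=\sum_{j=0}^{\ell-1}\mathrm{ev}_m(A_j^{(\ell)}(Y))\,E_{m+\ell-2j}+\sum_{j=0}^{\ell-1}\mathrm{ev}_m(B_j^{(\ell)}(Y))\,E_{-m+\ell-2j},$$ $$E_{-\ell}P_m=\sum_{j=0}^{\ell}\mathrm{ev}_m(tB_j^{(\ell+1)}(Y))\,E_{m-(\ell-2j)}+\sum_{j=0}^{\ell}\mathrm{ev}_m(A_j^{(\ell+1)}(Y))\,E_{-m-(\ell-2j)}.$$ -/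

import Mathlib

open scoped LaurentPolynomial

namespace SL2Macdonald

noncomputable section

/-- The `q`-Pochhammer symbol `(z;q)_j = (1-z)(1-zq)⋯(1-zq^{j-1})`. -/
def qPoch {F : Type*} [Field F] (q z : F) (j : ℕ) : F :=
  ∏ i ∈ Finset.range j, (1 - z * q ^ i)

/-- The `q`-`t`-binomial coefficient
`[ℓ,j]_{q,t} = ((q;q)_ℓ/(t;q)_ℓ) / (((q;q)_j/(t;q)_j) ((q;q)_{ℓ-j}/(t;q)_{ℓ-j}))`, for `0 ≤ j ≤ ℓ`. -/
def qtBinom {F : Type*} [Field F] (q t : F) (l j : ℕ) : F :=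
  (qPoch q q l / qPoch q t l) /
    ((qPoch q q j / qPoch q t j) * (qPoch q q (l - j) / qPoch q t (l - j)))

/-! ### The polynomial representation and the Macdonald polynomials

Here `qh` and `th` stand for the chosen square roots `q^{1/2}` and `t^{1/2}`,
and the Laurent polynomial variable `X` is `LaurentPolynomial.T 1`. -/

/-- The Laurent polynomial `(X^r - X^{-r}) / (1 - X^2)`, for `r ∈ ℤ`
(see `one_sub_mul_divDiff`). -/
def divDiff (K : Type*) [Field K] (r : ℤ) : K[T;T⁻¹] :=
  (-r.sign) • ∑ i ∈ Finset.range r.natAbs, LaurentPolynomial.T (-(r.natAbs : ℤ) + 2 * (i : ℤ))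

theorem one_sub_mul_divDiff (K : Type*) [Field K] (r : ℤ) :
    (1 - LaurentPolynomial.T 2) * divDiff K r
      = LaurentPolynomial.T r - LaurentPolynomial.T (-r) := by
  have key : ∀ n : ℕ, ((1 : K[T;T⁻¹]) - LaurentPolynomial.T 2) *
      ∑ i ∈ Finset.range n, LaurentPolynomial.T (-(n : ℤ) + 2 * (i : ℤ))
      = LaurentPolynomial.T (-(n : ℤ)) - LaurentPolynomial.T n := by
    intro n
    have h : ∀ k : ℕ, ((1 : K[T;T⁻¹]) - LaurentPolynomial.T 2) *
        ∑ i ∈ Finset.range k, LaurentPolynomial.T (-(n : ℤ) + 2 * (i : ℤ))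
        = LaurentPolynomial.T (-(n : ℤ)) - LaurentPolynomial.T (-(n : ℤ) + 2 * k) := by
      intro k
      induction k with
      | zero => simp
      | succ k ih =>
        rw [Finset.sum_range_succ, mul_add, ih, sub_mul, one_mul, ← LaurentPolynomial.T_add]
        have e : (2 : ℤ) + (-(n : ℤ) + 2 * (k : ℤ)) = -(n : ℤ) + 2 * ((k + 1 : ℕ) : ℤ) := by
          push_cast; ring
        rw [e]; ring
    rw [h n]
    congr 2
    ring
  unfold divDiff
  rw [mul_smul_comm, key]
  rcases lt_trichotomy r 0 with h | h | h
  · rw [Int.sign_eq_neg_one_of_neg h]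
    have e : (r.natAbs : ℤ) = -r := by omega
    rw [e]; simp
  · subst h; simp
  · rw [Int.sign_eq_one_of_pos h]
    have e : (r.natAbs : ℤ) = r := by omega
    rw [e]; simp

/-- The linear endomorphism of `K[X,X⁻¹]` with prescribed values on the monomials `X^r`. -/
def ofMonomials {K : Type*} [Field K] (g : ℤ → K[T;T⁻¹]) : K[T;T⁻¹] →ₗ[K] K[T;T⁻¹] :=
  (Finsupp.linearCombination K g) ∘ₗ (AddMonoidAlgebra.coeffLinearEquiv K).toLinearMap

theorem ofMonomials_T {K : Type*} [Field K] (g : ℤ → K[T;T⁻¹]) (r : ℤ) :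
    ofMonomials g (LaurentPolynomial.T r) = g r := by
  simp only [ofMonomials, LinearMap.comp_apply, LinearEquiv.coe_coe]
  exact (Finsupp.linearCombination_single K 1 r).trans (one_smul K (g r))

/-- The operator `T₁` of the polynomial representation:
`T₁ X^r = t^{1/2} X^{-r} + (t^{1/2} - t^{-1/2}) (X^r - X^{-r}) / (1 - X^2)`. -/
def opT1 {K : Type*} [Field K] (th : K) : K[T;T⁻¹] →ₗ[K] K[T;T⁻¹] :=
  ofMonomials fun r => th • LaurentPolynomial.T (-r) + (th - th⁻¹) • divDiff K r

/-- The operator `T_π` of the polynomial representation: `T_π X^r = q^{r/2} X^{-r}`. -/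
def opTpi {K : Type*} [Field K] (qh : K) : K[T;T⁻¹] →ₗ[K] K[T;T⁻¹] :=
  ofMonomials fun r => (qh ^ r) • LaurentPolynomial.T (-r)

/-- The operator `Y = T_π T₁` of the polynomial representation. -/
def opY {K : Type*} [Field K] (qh th : K) : K[T;T⁻¹] →ₗ[K] K[T;T⁻¹] :=
  opTpi qh ∘ₗ opT1 th

/-- The eigenvalue of `Y` on `E_r`: it is `t^{-1/2} q^{-r/2}` for `r > 0`
and `t^{1/2} q^{-r/2}` for `r ≤ 0`. -/
def eigY {K : Type*} [Field K] (qh th : K) (r : ℤ) : K :=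
  if 0 < r then th⁻¹ * qh ^ (-r) else th * qh ^ (-r)

/-- `f` is the `r`-th electronic Macdonald polynomial of type `SL₂`: it is an eigenvector of `Y`
with the eigenvalue `eigY qh th r`, and the coefficient of `X^r` in `f` is `1`. -/
def IsElectronic {K : Type*} [Field K] (qh th : K) (r : ℤ) (f : K[T;T⁻¹]) : Prop :=
  opY qh th f = eigY qh th r • f ∧ f.coeff r = 1

/-- The electronic Macdonald polynomial `E_r`, `r ∈ ℤ`: the Laurent polynomial determined by
`IsElectronic`. -/
def elecE {K : Type*} [Field K] (qh th : K) (r : ℤ) : K[T;T⁻¹] :=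
  Classical.epsilon (IsElectronic qh th r)

/-- The bosonic Macdonald polynomial `P_m = E_{-m} + t(1-q^m)/(1-tq^m) E_m`, `m ≥ 0`. -/
def bosP {K : Type*} [Field K] (qh th : K) (m : ℕ) : K[T;T⁻¹] :=
  elecE qh th (-(m : ℤ)) +
    (th ^ 2 * (1 - (qh ^ 2) ^ m) / (1 - th ^ 2 * (qh ^ 2) ^ m)) • elecE qh th m

/-! ### The universal coefficients

The formulas are written in a field `F` with elements `q t Y`; they are used for
`F = K(Y)`, the field of rational functions. -/

/-- The product expression for `C_j^{(ℓ)}(Y)`, for `0 ≤ j ≤ ℓ`. -/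
def formC {F : Type*} [Field F] (q t Y : F) (l j : ℕ) : F :=
  qtBinom q t l j *
    ((qPoch q (t⁻¹ * Y ^ (-2 : ℤ) * q ^ (-((j : ℤ) - 1))) j *
        qPoch q (t * Y ^ (-2 : ℤ) * q ^ ((l : ℤ) - 2 * j)) j) /
      (qPoch q (Y ^ (-2 : ℤ) * q ^ ((l : ℤ) - 2 * j + 1)) j *
        qPoch q (Y ^ (-2 : ℤ) * q ^ (-(j : ℤ))) j))

/-- The product expression for `A_j^{(ℓ)}(Y)`, for `0 ≤ j < ℓ`. -/
def formA {F : Type*} [Field F] (q t Y : F) (l j : ℕ) : F :=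
  qtBinom q t l j * ((1 - q ^ (l - j)) / (1 - q ^ l)) *
    ((qPoch q (t⁻¹ * Y ^ (-2 : ℤ) * q ^ (-((j : ℤ) - 1))) j *
        qPoch q (t * Y ^ (-2 : ℤ) * q ^ ((l : ℤ) - 2 * j)) j) /
      (qPoch q (Y ^ (-2 : ℤ) * q ^ (-(j : ℤ))) j *
        qPoch q (Y ^ (-2 : ℤ) * q ^ ((l : ℤ) - 2 * j)) j))

/-- The product expression for `B_j^{(ℓ)}(Y)`, for `0 ≤ j < ℓ`. -/
def formB {F : Type*} [Field F] (q t Y : F) (l j : ℕ) : F :=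
  q ^ j * qtBinom q t l j * ((1 - q ^ (l - j)) / (1 - q ^ l)) *
    ((qPoch q (t⁻¹ * Y ^ (-2 : ℤ) * q ^ (-((l : ℤ) - j - 1))) (l - j) *
        qPoch q (t * Y ^ (-2 : ℤ) * q ^ (-((l : ℤ) - 2 * j - 1))) (l - j - 1)) /
      (qPoch q (Y ^ (-2 : ℤ) * q ^ (-((l : ℤ) - 2 * j - 1))) (l - j) *
        qPoch q (Y ^ (-2 : ℤ) * q ^ (-((l : ℤ) - j - 1))) (l - j - 1)))

/-- `C_j^{(ℓ)}(Y)` as an element of `K(Y)`. -/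
def coefC {K : Type*} [Field K] (q t : K) (l j : ℕ) : RatFunc K :=
  formC (RatFunc.C q) (RatFunc.C t) RatFunc.X l j

/-- `A_j^{(ℓ)}(Y)` as an element of `K(Y)`. -/
def coefA {K : Type*} [Field K] (q t : K) (l j : ℕ) : RatFunc K :=
  formA (RatFunc.C q) (RatFunc.C t) RatFunc.X l j

/-- `B_j^{(ℓ)}(Y)` as an element of `K(Y)`. -/
def coefB {K : Type*} [Field K] (q t : K) (l j : ℕ) : RatFunc K :=
  formB (RatFunc.C q) (RatFunc.C t) RatFunc.X l j

/-- The point `t^{-1/2} q^{-m/2}` at which `ev_m` evaluates `Y`. -/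
def evPoint {K : Type*} [Field K] (qh th : K) (m : ℕ) : K :=
  th⁻¹ * qh ^ (-(m : ℤ))

/-- `f ∈ K(Y)` lies in the domain of `ev_m`: its denominator in lowest terms
does not evaluate to `0`. -/
def EvDefined {K : Type*} [Field K] (qh th : K) (m : ℕ) (f : RatFunc K) : Prop :=
  f.denom.eval (evPoint qh th m) ≠ 0

/-- The evaluation `ev_m`, with `ev_m(Y) = t^{-1/2} q^{-m/2}`, meaningful on the `f ∈ K(Y)` with
`EvDefined qh th m f`. -/
def ev {K : Type*} [Field K] (qh th : K) (m : ℕ) (f : RatFunc K) : K :=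
  f.eval (RingHom.id K) (evPoint qh th m)

end

end SL2Macdonald

open scoped LaurentPolynomial

namespace SL2Macdonald

noncomputable section

/-! ### The operators of the polynomial representation -/

section Operators

open LaurentPolynomial

variable {K : Type*} [Field K]

/-! Three facts about bosonic polynomials carry the product rules. First, `P_m` is invariant under
`X ↦ X⁻¹`, so multiplication by it commutes with `T₁` (`invert_bosP`, `opT1_mul_of_invert_eq`).
Second, the symmetrizer `1 + t^{1/2} T₁` sends `E_n` to `P_n` for `n > 0`, and `E_{-n}` to an
explicit multiple of `P_n` for `n ≥ 0`. Third, `X P_n = E_{n+1} + c_n E_{1-n}` with `c_n =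
(1-q^n)/(1-tq^n)` (`T_mul_bosP`).

These drive an induction on `ℓ` with `m` fixed. The third fact gives `E_{ℓ+1} P_m = X P_ℓ P_m - c_ℓ
E_{1-ℓ} P_m`, where `P_ℓ P_m` and `E_{1-ℓ} P_m` are already expanded. Symmetrizing the result gives
`P_{ℓ+1} P_m`, and `E_{-ℓ} = P_ℓ - t c_ℓ E_ℓ` gives the rule for negative index.

All comparisons are made term by term. With `ℓ = i + j`, the coefficients `A_j` and `B_i` at levels
`ℓ` and `ℓ+1` are all `C_j^{(ℓ)}` times elementary fractions, because the Pochhammer products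
telescope. The induction then reduces to three rational identities: `formA_succ_eq_sub`,
`formB_succ_eq_sub`, `formC_eq_add`. Since `C_j` vanishes under `ev_m` for `j > m`, and the other
coefficients with it, negative bosonic indices never matter.

The `E_r` are built from `1` by two intertwiners of `Y`. They are triangular in the monomials and
have distinct eigenvalues, so they form an eigenbasis, which gives existence and uniqueness. Finally
`HasEval` transfers the formulas from `K(Y)` to their values in `K`. -/

theorem linearMap_ext_T {M : Type*} [AddCommMonoid M] [Module K M] {f g : K[T;T⁻¹] →ₗ[K] M}
    (h : ∀ n : ℤ, f (T n) = g (T n)) : f = g := by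
  refine LinearMap.ext fun p => ?_
  induction p using LaurentPolynomial.induction_on' with
  | add p q hp hq => rw [map_add, map_add, hp, hq]
  | C_mul_T n a => rw [← smul_eq_C_mul, map_smul, map_smul, h]

theorem coeff_T (n r : ℤ) : (T n : K[T;T⁻¹]).coeff r = if n = r then 1 else 0 :=
  Finsupp.single_apply

theorem one_sub_T_two_ne_zero : (1 - T 2 : K[T;T⁻¹]) ≠ 0 := by
  intro h
  have h1 := congrArg (fun f : K[T;T⁻¹] => f.coeff 0) (sub_eq_zero.mp h)
  simp only [← T_zero, coeff_T] at h1
  simp at h1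

theorem T_one_mul_T_neg_one : (T 1 * T (-1) : K[T;T⁻¹]) = 1 := by
  rw [← T_add]; simp

theorem T_one_sq : (T 1 ^ 2 : K[T;T⁻¹]) = T 2 := by
  rw [T_pow]; simp

/-- The Demazure–Lusztig form of `T₁`, with the denominator `1 - X^2` cleared. -/
theorem one_sub_mul_opT1 (th : K) (f : K[T;T⁻¹]) :
    (1 - T 2) * opT1 th f
      = (C th * (1 - T 2) - (C th - C th⁻¹)) * invert f + (C th - C th⁻¹) * f := by
  have h : LinearMap.mulLeft K (1 - T 2 : K[T;T⁻¹]) ∘ₗ opT1 th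
      = LinearMap.mulLeft K (C th * (1 - T 2) - (C th - C th⁻¹)) ∘ₗ
          (invert (R := K)).toLinearMap
        + LinearMap.mulLeft K (C th - C th⁻¹) := by
    refine linearMap_ext_T fun n => ?_
    simp only [LinearMap.comp_apply, LinearMap.add_apply, LinearMap.mulLeft_apply, opT1,
      ofMonomials_T, AlgEquiv.toLinearMap_apply, invert_T, smul_eq_C_mul, map_sub]
    linear_combination (C th - C th⁻¹) * one_sub_mul_divDiff K n
  exact congrArg (fun φ => φ f) h

theorem C_mul_C_inv {a : K} (ha : a ≠ 0) : (C a * C a⁻¹ : K[T;T⁻¹]) = 1 := by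
  rw [← map_mul, mul_inv_cancel₀ ha, map_one]

/-- Inverting `X` in `one_sub_mul_opT1` and multiplying by `-X²` restores the factor `1 - X²`. This
is what makes compositions involving two copies of `T₁` computable. -/
theorem one_sub_mul_invert_opT1 (th : K) (f : K[T;T⁻¹]) :
    (1 - T 2) * invert (opT1 th f)
      = (C th * (1 - T 2) + (C th - C th⁻¹) * T 2) * f - (C th - C th⁻¹) * T 2 * invert f := by
  have h := congrArg (invert (R := K)) (one_sub_mul_opT1 th f)
  simp only [map_mul, map_add, map_sub, map_one, invert_T, invert_C,
    involutive_invert f] at h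
  have e : (T 2 * T (-2) : K[T;T⁻¹]) = 1 := by rw [← T_add]; simp
  linear_combination (-T 2) * h + (C th * f - invert (opT1 th f)) * e

/-- The quadratic Hecke relation. Laurent polynomials form a domain, so it suffices to check it
after multiplication by `(1 - X²)²`. -/
theorem opT1_opT1 {th : K} (ht : th ≠ 0) (f : K[T;T⁻¹]) :
    opT1 th (opT1 th f) = (th - th⁻¹) • opT1 th f + f := by
  refine mul_left_cancel₀ (pow_ne_zero 2 (one_sub_T_two_ne_zero (K := K))) ?_
  rw [smul_eq_C_mul, map_sub]
  linear_combination (1 - T 2) * one_sub_mul_opT1 th (opT1 th f)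
    + (C th * (1 - T 2) - (C th - C th⁻¹)) * one_sub_mul_invert_opT1 th f
    + (C th - C th⁻¹) * T 2 * one_sub_mul_opT1 th f + (1 - T 2) ^ 2 * f * C_mul_C_inv ht

/-- The cross relation `T₁ X T₁ = X⁻¹` of the affine Hecke algebra, in the form that `X T₁` is an
involution. -/
theorem T_mul_opT1_T_mul_opT1 {th : K} (ht : th ≠ 0) (f : K[T;T⁻¹]) :
    T 1 * opT1 th (T 1 * opT1 th f) = f := by
  refine mul_left_cancel₀ (pow_ne_zero 2 (one_sub_T_two_ne_zero (K := K))) ?_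
  have h := one_sub_mul_opT1 th (T 1 * opT1 th f)
  rw [map_mul invert, invert_T] at h
  linear_combination (1 - T 2) * T 1 * h
    + (C th * (1 - T 2) - (C th - C th⁻¹)) * one_sub_mul_invert_opT1 th f
    + (C th - C th⁻¹) * T 2 * one_sub_mul_opT1 th f + (1 - T 2) ^ 2 * f * C_mul_C_inv ht
    + (1 - T 2) * (C th * (1 - T 2) - (C th - C th⁻¹)) * invert (opT1 th f)
      * T_one_mul_T_neg_one (K := K)
    + (1 - T 2) * (C th - C th⁻¹) * opT1 th f * T_one_sq (K := K)

/-- `T₁` is linear over the symmetric Laurent polynomials. -/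
theorem opT1_mul_of_invert_eq (th : K) (f : K[T;T⁻¹]) {g : K[T;T⁻¹]} (hg : invert g = g) :
    opT1 th (f * g) = opT1 th f * g := by
  refine mul_left_cancel₀ (one_sub_T_two_ne_zero (K := K)) ?_
  have h := one_sub_mul_opT1 th (f * g)
  rw [map_mul invert, hg] at h
  linear_combination h - g * one_sub_mul_opT1 th f

/-- The Demazure–Lusztig form turns the hypothesis into `(t^{-1/2} - t^{1/2} X²)(g - g(X⁻¹)) = 0`,
and the first factor is nonzero. -/
theorem invert_eq_of_opT1_eq {th : K} (ht : th ≠ 0) {g : K[T;T⁻¹]}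
    (hg : opT1 th g = th • g) : invert g = g := by
  have h := one_sub_mul_opT1 th g
  rw [hg, smul_eq_C_mul] at h
  have hne : (C th * (1 - T 2) - (C th - C th⁻¹) : K[T;T⁻¹]) ≠ 0 := by
    intro h0
    have h1 := congrArg (fun f : K[T;T⁻¹] => f.coeff 2) h0
    have e : (C th * (1 - T 2) - (C th - C th⁻¹) : K[T;T⁻¹])
        = th⁻¹ • T 0 - th • T 2 := by rw [T_zero, smul_eq_C_mul, smul_eq_C_mul]; ring
    simp only [e, AddMonoidAlgebra.coeff_sub, AddMonoidAlgebra.coeff_smul, Finsupp.sub_apply,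
      Finsupp.smul_apply, coeff_T] at h1
    simp [ht] at h1
  refine mul_left_cancel₀ hne ?_
  linear_combination -h

theorem opTpi_T_mul {qh : K} (hq : qh ≠ 0) (n : ℤ) (f : K[T;T⁻¹]) :
    opTpi qh (T n * f) = qh ^ n • (T (-n) * opTpi qh f) := by
  have h : opTpi qh ∘ₗ LinearMap.mulLeft K (T n : K[T;T⁻¹])
      = qh ^ n • (LinearMap.mulLeft K (T (-n)) ∘ₗ opTpi qh) := by
    refine linearMap_ext_T fun k => ?_
    simp only [LinearMap.comp_apply, LinearMap.smul_apply, LinearMap.mulLeft_apply, opTpi,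
      ofMonomials_T, ← T_add, mul_smul_comm, smul_smul]
    rw [← zpow_add₀ hq, neg_add]
  exact congrArg (fun φ => φ f) h

theorem opTpi_opTpi {qh : K} (hq : qh ≠ 0) (f : K[T;T⁻¹]) : opTpi qh (opTpi qh f) = f := by
  have h : opTpi qh ∘ₗ opTpi qh = LinearMap.id := by
    refine linearMap_ext_T fun k => ?_
    simp only [LinearMap.comp_apply, opTpi, ofMonomials_T, map_smul, smul_smul, neg_neg,
      LinearMap.id_apply]
    rw [← zpow_add₀ hq]; simp
  exact congrArg (fun φ => φ f) h

theorem opT1_eq_of_opY_eq {qh th y : K} (hq : qh ≠ 0) {f : K[T;T⁻¹]}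
    (h : opY qh th f = y • f) : opT1 th f = y • opTpi qh f := by
  rw [← map_smul, ← h, opY, LinearMap.comp_apply, opTpi_opTpi hq]

/-- `X T_π` intertwines the eigenspaces of `Y`. -/
theorem opY_T_mul_opTpi {qh th y : K} (hq : qh ≠ 0) (ht : th ≠ 0) (hy : y ≠ 0)
    {f : K[T;T⁻¹]} (h : opY qh th f = y • f) :
    opY qh th (T 1 * opTpi qh f) = (qh⁻¹ * y⁻¹) • (T 1 * opTpi qh f) := by
  have h1 := opT1_eq_of_opY_eq hq h
  have h2 := T_mul_opT1_T_mul_opT1 ht f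
  rw [h1, mul_smul_comm, map_smul] at h2
  have h3 := congrArg (opTpi qh) h2
  rw [opTpi_T_mul hq, map_smul] at h3
  have h4 : opTpi qh (opT1 th (T 1 * opTpi qh f)) = opY qh th (T 1 * opTpi qh f) := rfl
  rw [h4, zpow_one] at h3
  conv_rhs => rw [← h3]
  rw [mul_smul_comm, mul_smul_comm, mul_smul_comm, ← mul_assoc, T_one_mul_T_neg_one,
    one_mul, smul_smul, smul_smul, show qh⁻¹ * y⁻¹ * qh * y = 1 by field_simp, one_smul]

/-- `T₁ + (th - th⁻¹) / (y⁻² - 1)` intertwines the eigenspaces of `Y`. -/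
theorem opY_opT1_add {qh th y k : K} (hq : qh ≠ 0) (ht : th ≠ 0) (hy : y ≠ 0)
    (hk : k * (y⁻¹ - y) = (th - th⁻¹) * y) {f : K[T;T⁻¹]} (h : opY qh th f = y • f) :
    opY qh th (opT1 th f + k • f) = y⁻¹ • (opT1 th f + k • f) := by
  have h1 := opT1_eq_of_opY_eq hq h
  have h2 : opY qh th (opT1 th f) = (th - th⁻¹) • (y • f) + y⁻¹ • opT1 th f := by
    rw [← h, h1, smul_smul, inv_mul_cancel₀ hy, one_smul, ← h1]
    simp only [opY, LinearMap.comp_apply]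
    rw [opT1_opT1 ht, map_add, map_smul]
  rw [map_add, map_smul, h2, h]
  simp only [smul_add, smul_smul]
  rw [show y⁻¹ * k = (th - th⁻¹) * y + k * y by linear_combination hk, add_smul]
  abel

end Operators

/-! ### Genericity of the parameters -/

/-- `qh`, `th` are nonzero and their squares are multiplicatively independent. -/
structure Generic {K : Type*} [Field K] (qh th : K) : Prop where
  qh_ne : qh ≠ 0
  th_ne : th ≠ 0
  indep : ∀ a b : ℤ, (qh ^ 2) ^ a * (th ^ 2) ^ b = 1 → a = 0 ∧ b = 0

namespace Generic

variable {K : Type*} [Field K] {qh th : K}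

theorem q_ne (h : Generic qh th) : qh ^ 2 ≠ 0 := pow_ne_zero _ h.qh_ne

theorem t_ne (h : Generic qh th) : th ^ 2 ≠ 0 := pow_ne_zero _ h.th_ne

theorem one_sub_ne (h : Generic qh th) {a b : ℤ} (hab : a ≠ 0 ∨ b ≠ 0) :
    1 - (th ^ 2) ^ b * (qh ^ 2) ^ a ≠ 0 := by
  intro h0
  have := h.indep a b (by linear_combination -h0)
  omega

theorem one_sub_q_pow_ne (h : Generic qh th) {n : ℕ} (hn : n ≠ 0) : 1 - (qh ^ 2) ^ n ≠ 0 := by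
  simpa using h.one_sub_ne (a := n) (b := 0) (by omega)

theorem one_sub_t_mul_zpow_ne (h : Generic qh th) (n : ℤ) : 1 - th ^ 2 * (qh ^ 2) ^ n ≠ 0 := by
  simpa using h.one_sub_ne (a := n) (b := 1) (by omega)

theorem one_sub_t_mul_pow_ne (h : Generic qh th) (n : ℕ) : 1 - th ^ 2 * (qh ^ 2) ^ n ≠ 0 := by
  simpa using h.one_sub_t_mul_zpow_ne n

theorem one_sub_t_sq_mul_zpow_ne (h : Generic qh th) (n : ℤ) :
    1 - th ^ 2 * (th ^ 2 * (qh ^ 2) ^ n) ≠ 0 := by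
  have := h.one_sub_ne (a := n) (b := 2) (by omega)
  rwa [show ((th ^ 2) ^ (2 : ℤ)) = th ^ 2 * th ^ 2 by rw [zpow_ofNat, sq (th ^ 2)],
    mul_assoc] at this

theorem eigY_injective (h : Generic qh th) : Function.Injective (eigY qh th) := by
  have hq := h.q_ne
  have ht := h.t_ne
  have key : ∀ r : ℤ,
      -- Independence concerns `q` and `t`, not their roots, so eigenvalues are compared through
      -- their squares.
      eigY qh th r ^ 2 = (qh ^ 2) ^ (-r) * (th ^ 2) ^ (if 0 < r then (-1 : ℤ) else 1) := by
    intro r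
    have e : (qh ^ (-r)) ^ 2 = (qh ^ 2) ^ (-r) := by
      rw [← zpow_natCast, ← zpow_natCast, ← zpow_mul, ← zpow_mul, mul_comm]
    unfold eigY
    split_ifs
    · rw [mul_pow, e, zpow_neg_one, inv_pow, mul_comm]
    · rw [mul_pow, e, zpow_one, mul_comm]
  intro r s hrs
  have h1 := key r
  rw [hrs, key s] at h1
  have h2 := h.indep (-s - -r)
    ((if 0 < s then (-1 : ℤ) else 1) - (if 0 < r then (-1 : ℤ) else 1)) (by
      rw [zpow_sub₀ hq, zpow_sub₀ ht, div_mul_div_comm, h1]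
      exact div_self (mul_ne_zero (zpow_ne_zero _ hq) (zpow_ne_zero _ ht)))
  omega

end Generic

/-! ### Spans of monomials -/

section MonomialSpan

open LaurentPolynomial

variable {K : Type*} [Field K]

/-- The span of the monomials `X^r` with `a ≤ r ≤ b`. -/
def monomialSpan (K : Type*) [Field K] (a b : ℤ) : Submodule K K[T;T⁻¹] :=
  Submodule.span K (T '' Set.Icc a b)

theorem T_mem_monomialSpan {a b r : ℤ} (ha : a ≤ r) (hb : r ≤ b) :
    (T r : K[T;T⁻¹]) ∈ monomialSpan K a b :=
  Submodule.subset_span ⟨r, ⟨ha, hb⟩, rfl⟩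

theorem map_mem_of_mem_monomialSpan {a b : ℤ} {S : Submodule K K[T;T⁻¹]}
    {φ : K[T;T⁻¹] →ₗ[K] K[T;T⁻¹]} (h : ∀ r, a ≤ r → r ≤ b → φ (T r) ∈ S)
    {g : K[T;T⁻¹]} (hg : g ∈ monomialSpan K a b) : φ g ∈ S := by
  have : monomialSpan K a b ≤ S.comap φ := by
    refine Submodule.span_le.mpr ?_
    rintro _ ⟨r, hr, rfl⟩
    exact h r hr.1 hr.2
  exact this hg

theorem monomialSpan_le {a b : ℤ} {S : Submodule K K[T;T⁻¹]}
    (h : ∀ r, a ≤ r → r ≤ b → (T r : K[T;T⁻¹]) ∈ S) : monomialSpan K a b ≤ S :=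
  fun _ hg => map_mem_of_mem_monomialSpan (φ := LinearMap.id) h hg

theorem monomialSpan_mono {a b a' b' : ℤ} (ha : a' ≤ a) (hb : b ≤ b') :
    monomialSpan K a b ≤ monomialSpan K a' b' :=
  monomialSpan_le fun _ h1 h2 => T_mem_monomialSpan (ha.trans h1) (h2.trans hb)

theorem coeff_eq_zero_of_mem_monomialSpan {a b r : ℤ} (hr : r < a ∨ b < r) {g : K[T;T⁻¹]}
    (hg : g ∈ monomialSpan K a b) : g.coeff r = 0 := by
  induction hg using Submodule.span_induction with
  | mem x hx =>
    obtain ⟨s, hs, rfl⟩ := hx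
    rw [coeff_T, if_neg]
    rintro rfl
    have := hs.1
    have := hs.2
    omega
  | zero => simp
  | add x y _ _ hx hy => simp [hx, hy]
  | smul c x _ hx => simp [hx]

/-! ### Triangularity of the operators -/

theorem divDiff_zero : divDiff K 0 = 0 := by simp [divDiff]

theorem divDiff_mem_monomialSpan {r n : ℤ} (h1 : -n ≤ r) (h2 : r ≤ n) :
    divDiff K r ∈ monomialSpan K (-n) n := by
  refine Submodule.smul_of_tower_mem _ _ (Submodule.sum_mem _ fun i hi => ?_)
  have := Finset.mem_range.mp hi
  exact T_mem_monomialSpan (by omega) (by omega)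

theorem opT1_mem_monomialSpan (th : K) {n : ℤ} {g : K[T;T⁻¹]}
    (hg : g ∈ monomialSpan K (-n) n) : opT1 th g ∈ monomialSpan K (-n) n := by
  refine map_mem_of_mem_monomialSpan (fun r h1 h2 => ?_) hg
  rw [opT1, ofMonomials_T]
  exact add_mem (Submodule.smul_mem _ _ (T_mem_monomialSpan (by omega) (by omega)))
    (Submodule.smul_mem _ _ (divDiff_mem_monomialSpan h1 h2))

/-- In the lowest monomial, `t^{1/2}` from the reflection and `-(t^{1/2} - t^{-1/2})` from the
divided difference add up to `t^{-1/2}`. This is why `elecNeg` is rescaled by `t^{1/2}`. -/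
theorem opT1_T_sub_mem_monomialSpan (th : K) (n : ℕ) :
    opT1 th (T (n + 1)) - th⁻¹ • T (-((n : ℤ) + 1)) ∈ monomialSpan K (-n) (n + 1) := by
  have e : opT1 th (T (n + 1)) - th⁻¹ • T (-((n : ℤ) + 1))
      = -((th - th⁻¹) • ∑ i ∈ Finset.range n,
          (T (-((n : ℤ) + 1) + 2 * ((i + 1 : ℕ) : ℤ)) : K[T;T⁻¹])) := by
    have hs : ((n : ℤ) + 1).sign = 1 := Int.sign_eq_one_of_pos (by omega)
    have hn : ((n : ℤ) + 1).natAbs = n + 1 := by omega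
    rw [opT1, ofMonomials_T, divDiff, hs, hn, Finset.sum_range_succ']
    push_cast
    simp only [add_zero, neg_smul, one_smul, smul_eq_C_mul, map_sub]
    ring
  rw [e]
  refine neg_mem (Submodule.smul_mem _ _ (Submodule.sum_mem _ fun i hi => ?_))
  have := Finset.mem_range.mp hi
  push_cast
  exact T_mem_monomialSpan (by omega) (by omega)

theorem T_mul_opTpi_T (qh : K) (r : ℤ) :
    T 1 * opTpi qh (T r) = qh ^ r • (T (1 - r) : K[T;T⁻¹]) := by
  rw [opTpi, ofMonomials_T, mul_smul_comm, ← T_add, sub_eq_add_neg]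

end MonomialSpan

/-! ### Construction of the electronic Macdonald polynomials -/

section Construction

open LaurentPolynomial

variable {K : Type*} [Field K]

/-- The constant for which `T₁ + shiftCoeff` maps `E_n` to a multiple of `E_{-n}`. -/
def shiftCoeff (qh th : K) (n : ℕ) : K := (th - th⁻¹) / (th ^ 2 * (qh ^ 2) ^ n - 1)

/-- The polynomials `E_{-n}`, constructed with the intertwiners. -/
def elecNeg (qh th : K) : ℕ → K[T;T⁻¹]
  | 0 => 1
  | n + 1 => th • (opT1 th (qh ^ n • (T 1 * opTpi qh (elecNeg qh th n)))
      + shiftCoeff qh th (n + 1) • (qh ^ n • (T 1 * opTpi qh (elecNeg qh th n))))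

/-- The polynomials `E_{n+1}`, constructed with the intertwiners. -/
def elecPos (qh th : K) (n : ℕ) : K[T;T⁻¹] := qh ^ n • (T 1 * opTpi qh (elecNeg qh th n))

theorem elecNeg_succ (qh th : K) (n : ℕ) :
    elecNeg qh th (n + 1)
      = th • (opT1 th (elecPos qh th n) + shiftCoeff qh th (n + 1) • elecPos qh th n) := rfl

variable {qh th : K}

theorem opY_elecPos_of_elecNeg (h : Generic qh th) (n : ℕ)
    (hn : opY qh th (elecNeg qh th n) = (th * qh ^ n) • elecNeg qh th n) :
    opY qh th (elecPos qh th n) = (th⁻¹ * (qh ^ (n + 1))⁻¹) • elecPos qh th n := by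
  have h1 := opY_T_mul_opTpi h.qh_ne h.th_ne (mul_ne_zero h.th_ne (pow_ne_zero n h.qh_ne)) hn
  rw [elecPos, map_smul, h1, smul_comm]
  rw [show qh⁻¹ * (th * qh ^ n)⁻¹ = th⁻¹ * (qh ^ (n + 1))⁻¹ by
    rw [mul_inv, pow_succ, mul_inv]; ring]

theorem opY_elecNeg (h : Generic qh th) (n : ℕ) :
    opY qh th (elecNeg qh th n) = (th * qh ^ n) • elecNeg qh th n := by
  induction n with
  | zero =>
    have e : elecNeg qh th 0 = T 0 := T_zero.symm
    rw [e, opY, LinearMap.comp_apply, opT1, ofMonomials_T, divDiff_zero, smul_zero,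
      add_zero, map_smul, neg_zero, opTpi, ofMonomials_T, zpow_zero, neg_zero, one_smul, pow_zero,
      mul_one]
  | succ n ih =>
    have h1 := opY_elecPos_of_elecNeg h n ih
    have hq := h.qh_ne
    have ht := h.th_ne
    have hne := h.one_sub_t_mul_pow_ne (n + 1)
    -- The condition on the constant in `opY_opT1_add` at `y = t^{-1/2} q^{-(n+1)/2}`, where `y⁻² =
    -- t q^{n+1}`.
    have hk : shiftCoeff qh th (n + 1)
          * ((th⁻¹ * (qh ^ (n + 1))⁻¹)⁻¹ - th⁻¹ * (qh ^ (n + 1))⁻¹)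
        = (th - th⁻¹) * (th⁻¹ * (qh ^ (n + 1))⁻¹) := by
      have hne' : th ^ 2 * (qh ^ 2) ^ (n + 1) - 1 ≠ 0 := fun h0 => hne (by linear_combination -h0)
      have hQ : qh ^ (n + 1) ≠ 0 := pow_ne_zero _ hq
      unfold shiftCoeff
      rw [← pow_mul, mul_comm 2, pow_mul] at hne' ⊢
      generalize qh ^ (n + 1) = Q at *
      field_simp
    have h2 := opY_opT1_add hq ht
      (mul_ne_zero (inv_ne_zero ht) (inv_ne_zero (pow_ne_zero (n + 1) hq))) hk h1
    rw [elecNeg_succ, map_smul, h2, smul_comm, mul_inv, inv_inv, inv_inv]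

theorem opY_elecPos (h : Generic qh th) (n : ℕ) :
    opY qh th (elecPos qh th n) = (th⁻¹ * (qh ^ (n + 1))⁻¹) • elecPos qh th n :=
  opY_elecPos_of_elecNeg h n (opY_elecNeg h n)

theorem elecPos_sub_T_mem_of_elecNeg (hq : qh ≠ 0) (n : ℕ)
    (hn : elecNeg qh th n - T (-(n : ℤ)) ∈ monomialSpan K (1 - n) n) :
    elecPos qh th n - T (n + 1) ∈ monomialSpan K (-n) n := by
  have e : elecPos qh th n - T (n + 1)
      = qh ^ n • (LinearMap.mulLeft K (T 1) ∘ₗ opTpi qh) (elecNeg qh th n - T (-(n : ℤ))) := by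
    rw [map_sub, smul_sub]
    simp only [LinearMap.comp_apply, LinearMap.mulLeft_apply, T_mul_opTpi_T, smul_smul]
    rw [zpow_neg, zpow_natCast, mul_inv_cancel₀ (pow_ne_zero _ hq), one_smul, elecPos,
      sub_neg_eq_add, add_comm (1 : ℤ)]
  rw [e]
  refine Submodule.smul_mem _ _ (map_mem_of_mem_monomialSpan (fun r h1 h2 => ?_) hn)
  simp only [LinearMap.comp_apply, LinearMap.mulLeft_apply, T_mul_opTpi_T]
  exact Submodule.smul_mem _ _ (T_mem_monomialSpan (by omega) (by omega))

/-- Triangularity for the order `0, 1, -1, 2, -2, …` of exponents: `X T_π` reflects `r` to `1 - r`,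
and `T₁` reflects `r` to `-r` up to exponents between. -/
theorem elecNeg_sub_T_mem (hq : qh ≠ 0) (ht : th ≠ 0) (n : ℕ) :
    elecNeg qh th n - T (-(n : ℤ)) ∈ monomialSpan K (1 - n) n := by
  induction n with
  | zero => simp [elecNeg]
  | succ n ih =>
    have h1 := elecPos_sub_T_mem_of_elecNeg hq n ih
    have h2 := opT1_mem_monomialSpan th h1
    have h3 := opT1_T_sub_mem_monomialSpan th n
    have le : monomialSpan K (-(n : ℤ)) n ≤ monomialSpan K (-n) (n + 1) :=
      monomialSpan_mono le_rfl (by omega)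
    have h4 : (T (n + 1) : K[T;T⁻¹]) ∈ monomialSpan K (-n) (n + 1) :=
      T_mem_monomialSpan (by omega) le_rfl
    have e : elecNeg qh th (n + 1) - T (-((n + 1 : ℕ) : ℤ))
        = th • (opT1 th (elecPos qh th n - T (n + 1))
          + (opT1 th (T (n + 1)) - th⁻¹ • T (-((n : ℤ) + 1)))
          + shiftCoeff qh th (n + 1) • ((elecPos qh th n - T (n + 1)) + T (n + 1))) := by
      rw [elecNeg_succ, map_sub, sub_add_cancel, sub_add_sub_cancel, sub_add_eq_add_sub, smul_sub,
        smul_smul, mul_inv_cancel₀ ht, one_smul]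
      push_cast
      rfl
    rw [e]
    push_cast
    rw [show (1 : ℤ) - (n + 1) = -n by ring]
    exact Submodule.smul_mem _ _ (add_mem (add_mem (le h2) h3)
      (Submodule.smul_mem _ _ (add_mem (le h1) h4)))

theorem elecPos_sub_T_mem (hq : qh ≠ 0) (ht : th ≠ 0) (n : ℕ) :
    elecPos qh th n - T (n + 1) ∈ monomialSpan K (-n) n :=
  elecPos_sub_T_mem_of_elecNeg hq n (elecNeg_sub_T_mem hq ht n)

/-! ### The eigenbasis and uniqueness -/

theorem isElectronic_elecNeg (h : Generic qh th) (n : ℕ) :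
    IsElectronic qh th (-(n : ℤ)) (elecNeg qh th n) := by
  constructor
  · rw [opY_elecNeg h, eigY, if_neg (by omega), neg_neg, zpow_natCast]
  · have h1 := coeff_eq_zero_of_mem_monomialSpan (r := -(n : ℤ)) (Or.inl (by omega))
      (elecNeg_sub_T_mem h.qh_ne h.th_ne n)
    rw [AddMonoidAlgebra.coeff_sub, Finsupp.sub_apply, coeff_T, if_pos rfl] at h1
    exact sub_eq_zero.mp h1

theorem isElectronic_elecPos (h : Generic qh th) (n : ℕ) :
    IsElectronic qh th ((n + 1 : ℕ) : ℤ) (elecPos qh th n) := by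
  constructor
  · rw [opY_elecPos h, eigY, if_pos (by omega), zpow_neg, zpow_natCast]
  · have h1 := coeff_eq_zero_of_mem_monomialSpan (r := ((n + 1 : ℕ) : ℤ)) (Or.inr (by omega))
      (elecPos_sub_T_mem h.qh_ne h.th_ne n)
    rw [AddMonoidAlgebra.coeff_sub, Finsupp.sub_apply, coeff_T, if_pos (by push_cast; rfl)] at h1
    exact sub_eq_zero.mp h1

/-- The family `E_r`, `r ∈ ℤ`, constructed with the intertwiners. -/
def elecFamily (qh th : K) : ℤ → K[T;T⁻¹]
  | Int.ofNat 0 => elecNeg qh th 0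
  | Int.ofNat (n + 1) => elecPos qh th n
  | Int.negSucc n => elecNeg qh th (n + 1)

theorem elecFamily_neg (n : ℕ) : elecFamily qh th (-(n : ℤ)) = elecNeg qh th n := by
  cases n <;> rfl

theorem isElectronic_elecFamily (h : Generic qh th) (r : ℤ) :
    IsElectronic qh th r (elecFamily qh th r) := by
  match r with
  | Int.ofNat 0 => exact isElectronic_elecNeg h 0
  | Int.ofNat (n + 1) => exact isElectronic_elecPos h n
  | Int.negSucc n => exact isElectronic_elecNeg h (n + 1)

theorem IsElectronic.ne_zero {r : ℤ} {f : K[T;T⁻¹]} (hf : IsElectronic qh th r f) : f ≠ 0 := by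
  rintro rfl
  simpa using hf.2

theorem linearIndependent_elecFamily (h : Generic qh th) :
    LinearIndependent K (elecFamily qh th) :=
  Module.End.eigenvectors_linearIndependent' (opY qh th) (eigY qh th) h.eigY_injective _
    fun r => ⟨Module.End.mem_eigenspace_iff.mpr (isElectronic_elecFamily h r).1,
      (isElectronic_elecFamily h r).ne_zero⟩

theorem top_le_span_elecFamily (h : Generic qh th) :
    ⊤ ≤ Submodule.span K (Set.range (elecFamily qh th)) := by
  have mem : ∀ r, elecFamily qh th r ∈ Submodule.span K (Set.range (elecFamily qh th)) :=
    fun r => Submodule.subset_span ⟨r, rfl⟩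
  have key : ∀ n : ℕ,
      monomialSpan K (-n) n ≤ Submodule.span K (Set.range (elecFamily qh th)) := by
    intro n
    induction n with
    | zero =>
      refine monomialSpan_le fun r h1 h2 => ?_
      obtain rfl : r = 0 := by omega
      rw [T_zero]
      exact mem 0
    | succ n ih =>
      have h1 : (T (n + 1) : K[T;T⁻¹]) ∈ Submodule.span K (Set.range (elecFamily qh th)) := by
        have := sub_mem (mem ((n + 1 : ℕ) : ℤ)) (ih (elecPos_sub_T_mem h.qh_ne h.th_ne n))
        rwa [show elecFamily qh th ((n + 1 : ℕ) : ℤ) = elecPos qh th n from rfl,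
          sub_sub_cancel] at this
      have h2 : monomialSpan K (1 - (n + 1 : ℕ)) (n + 1 : ℕ)
          ≤ Submodule.span K (Set.range (elecFamily qh th)) := by
        refine monomialSpan_le fun r hr1 hr2 => ?_
        rcases eq_or_ne r (n + 1) with rfl | hr
        · exact h1
        · exact ih (T_mem_monomialSpan (by omega) (by omega))
      have h3 : (T (-((n + 1 : ℕ) : ℤ)) : K[T;T⁻¹])
          ∈ Submodule.span K (Set.range (elecFamily qh th)) := by
        have := sub_mem (mem (-((n + 1 : ℕ) : ℤ)))
          (h2 (elecNeg_sub_T_mem h.qh_ne h.th_ne (n + 1)))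
        rwa [elecFamily_neg, sub_sub_cancel] at this
      refine monomialSpan_le fun r hr1 hr2 => ?_
      rcases eq_or_ne r (-((n + 1 : ℕ) : ℤ)) with rfl | hr
      · exact h3
      · exact h2 (T_mem_monomialSpan (by omega) (by omega))
  intro f _
  induction f using LaurentPolynomial.induction_on' with
  | add p q hp hq => exact add_mem (hp trivial) (hq trivial)
  | C_mul_T n a =>
    rw [← smul_eq_C_mul]
    exact Submodule.smul_mem _ _
      (key n.natAbs (T_mem_monomialSpan (by omega) (by omega)))

/-- In the eigenbasis, distinct eigenvalues kill every coordinate of `f` except the `r`-th, which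
the normalization forces to be `1`. -/
theorem isElectronic_unique (h : Generic qh th) {r : ℤ} {f : K[T;T⁻¹]}
    (hf : IsElectronic qh th r f) : f = elecFamily qh th r := by
  let B := Module.Basis.mk (linearIndependent_elecFamily h) (top_le_span_elecFamily h)
  have hB : ∀ s, B s = elecFamily qh th s := fun s => by simp [B]
  have hrepr : ∀ (g : K[T;T⁻¹]) (s : ℤ), B.coord s (opY qh th g) = eigY qh th s * B.coord s g := by
    intro g s
    have : B.coord s ∘ₗ opY qh th = eigY qh th s • B.coord s := by
      refine B.ext fun u => ?_
      have hu : opY qh th (B u) = eigY qh th u • B u := by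
        rw [hB]; exact (isElectronic_elecFamily h u).1
      rw [LinearMap.comp_apply, hu, map_smul, LinearMap.smul_apply, B.coord_apply, B.repr_self]
      rcases eq_or_ne u s with rfl | hus
      · rfl
      · simp [hus]
    exact congrArg (fun φ => φ g) this
  have hzero : ∀ s, s ≠ r → B.coord s f = 0 := by
    intro s hs
    have h1 := hrepr f s
    rw [hf.1, map_smul, smul_eq_mul] at h1
    have h2 : (eigY qh th r - eigY qh th s) * B.coord s f = 0 := by linear_combination h1
    exact (mul_eq_zero.mp h2).resolve_left
      (sub_ne_zero.mpr fun h3 => hs (h.eigY_injective h3).symm)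
  have hfr : f = B.coord r f • elecFamily qh th r := by
    refine B.repr.injective (Finsupp.ext fun s => ?_)
    rw [← hB, map_smul, B.repr_self]
    rcases eq_or_ne s r with rfl | hs
    · simp
    · simpa [hs.symm] using hzero s hs
  have h1 := hf.2
  rw [hfr, AddMonoidAlgebra.coeff_smul, Finsupp.smul_apply, (isElectronic_elecFamily h r).2,
    smul_eq_mul, mul_one] at h1
  rw [hfr, h1, one_smul]

theorem existsUnique_isElectronic (h : Generic qh th) (r : ℤ) :
    ∃! f : K[T;T⁻¹], IsElectronic qh th r f :=
  ⟨_, isElectronic_elecFamily h r, fun _ hf => isElectronic_unique h hf⟩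

theorem elecE_eq_elecFamily (h : Generic qh th) (r : ℤ) :
    elecE qh th r = elecFamily qh th r :=
  isElectronic_unique h (Classical.epsilon_spec ⟨_, isElectronic_elecFamily h r⟩)

end Construction

/-! ### Symmetrization and multiplication by `X` -/

section Symmetrization

open LaurentPolynomial

variable {K : Type*} [Field K] {qh th : K}

theorem elecE_neg (h : Generic qh th) (n : ℕ) : elecE qh th (-(n : ℤ)) = elecNeg qh th n := by
  rw [elecE_eq_elecFamily h, elecFamily_neg]

theorem elecE_succ (h : Generic qh th) (n : ℕ) :
    elecE qh th ((n : ℤ) + 1) = elecPos qh th n :=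
  elecE_eq_elecFamily h ((n : ℤ) + 1)

theorem elecE_zero (h : Generic qh th) : elecE qh th 0 = 1 := elecE_neg h 0

/-- The coefficient of `E_m` in `P_m`. -/
def bosCoeff (qh th : K) (m : ℕ) : K :=
  th ^ 2 * (1 - (qh ^ 2) ^ m) / (1 - th ^ 2 * (qh ^ 2) ^ m)

/-- The coefficient of `E_{1-m}` in `X P_m`. -/
def mulXCoeff (qh th : K) (m : ℕ) : K :=
  (1 - (qh ^ 2) ^ m) / (1 - th ^ 2 * (qh ^ 2) ^ m)

/-- The symmetrization of `E_{-m}` is this multiple of `P_m`. -/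
def symCoeff (qh th : K) (m : ℕ) : K :=
  (1 - th ^ 2 * (th ^ 2 * (qh ^ 2) ^ m)) / (1 - th ^ 2 * (qh ^ 2) ^ m)

theorem bosCoeff_eq (m : ℕ) : bosCoeff qh th m = th ^ 2 * mulXCoeff qh th m := by
  rw [bosCoeff, mulXCoeff, mul_div_assoc]

theorem mulXCoeff_zero : mulXCoeff qh th 0 = 0 := by simp [mulXCoeff]

theorem bosP_eq (m : ℕ) :
    bosP qh th m = elecE qh th (-(m : ℤ)) + bosCoeff qh th m • elecE qh th m := rfl

theorem bosP_zero (h : Generic qh th) : bosP qh th 0 = 1 := by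
  rw [bosP_eq, bosCoeff_eq, mulXCoeff_zero, mul_zero, zero_smul, add_zero, elecE_neg h]
  rfl

/-- The symmetrizer `1 + t^{1/2} T₁`. -/
def symmetrizer (th : K) : K[T;T⁻¹] →ₗ[K] K[T;T⁻¹] := LinearMap.id + th • opT1 th

theorem symmetrizer_apply (f : K[T;T⁻¹]) : symmetrizer th f = f + th • opT1 th f := rfl

theorem opT1_symmetrizer (ht : th ≠ 0) (f : K[T;T⁻¹]) :
    opT1 th (symmetrizer th f) = th • symmetrizer th f := by
  rw [symmetrizer_apply, map_add, map_smul, opT1_opT1 ht, smul_add, smul_add, smul_smul, smul_smul,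
    mul_sub, mul_inv_cancel₀ ht, sub_smul, one_smul]
  abel

theorem symmetrizer_opT1 (ht : th ≠ 0) (f : K[T;T⁻¹]) :
    symmetrizer th (opT1 th f) = th • symmetrizer th f := by
  rw [← opT1_symmetrizer ht, symmetrizer_apply, symmetrizer_apply, map_add, map_smul]

theorem symmetrizer_mul_of_invert_eq (f : K[T;T⁻¹]) {g : K[T;T⁻¹]} (hg : invert g = g) :
    symmetrizer th (f * g) = symmetrizer th f * g := by
  rw [symmetrizer_apply, symmetrizer_apply, opT1_mul_of_invert_eq th f hg, add_mul, smul_mul_assoc]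

/-- By construction `E_{-(n+1)} = t^{1/2} (T₁ + k) E_{n+1}`, so the symmetrization is `E_{-(n+1)} +
(1 - t^{1/2} k) E_{n+1}`, and `1 - t^{1/2} k` is the coefficient defining `P_{n+1}`. -/
theorem symmetrizer_elecE_succ (h : Generic qh th) (n : ℕ) :
    symmetrizer th (elecE qh th ((n : ℤ) + 1)) = bosP qh th (n + 1) := by
  have ht := h.th_ne
  have hne := h.one_sub_t_mul_pow_ne (n + 1)
  have hne' : th ^ 2 * (qh ^ 2) ^ (n + 1) - 1 ≠ 0 := fun h0 => hne (by linear_combination -h0)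
  have hc : th * shiftCoeff qh th (n + 1) + bosCoeff qh th (n + 1) = 1 := by
    unfold shiftCoeff bosCoeff
    rw [← neg_sub (th ^ 2 * (qh ^ 2) ^ (n + 1)) 1]
    generalize (qh ^ 2) ^ (n + 1) = Q at *
    field_simp
    ring
  rw [bosP_eq, elecE_neg h, elecNeg_succ]
  push_cast
  rw [elecE_succ h, symmetrizer_apply, smul_add, add_assoc, smul_smul, ← add_smul, hc, one_smul,
    add_comm]

theorem opT1_bosP (h : Generic qh th) (n : ℕ) : opT1 th (bosP qh th n) = th • bosP qh th n := by
  cases n with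
  | zero =>
    rw [bosP_zero h, ← T_zero, opT1, ofMonomials_T, divDiff_zero, smul_zero, add_zero, neg_zero]
  | succ n => rw [← symmetrizer_elecE_succ h, opT1_symmetrizer h.th_ne]

theorem invert_bosP (h : Generic qh th) (n : ℕ) : invert (bosP qh th n) = bosP qh th n :=
  invert_eq_of_opT1_eq h.th_ne (opT1_bosP h n)

theorem symmetrizer_elecE_neg (h : Generic qh th) (n : ℕ) :
    symmetrizer th (elecE qh th (-(n : ℤ))) = symCoeff qh th n • bosP qh th n := by
  have ht := h.th_ne
  cases n with
  | zero =>
    have hne := h.one_sub_t_mul_pow_ne 0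
    rw [elecE_neg h, show elecNeg qh th 0 = bosP qh th 0 from (bosP_zero h).symm, symmetrizer_apply,
      opT1_bosP h, smul_smul]
    have e : symCoeff qh th 0 = 1 + th * th := by
      unfold symCoeff
      rw [div_eq_iff hne]
      ring
    rw [e, add_smul, one_smul]
  | succ n =>
    have hne := h.one_sub_t_mul_pow_ne (n + 1)
    have hne' : th ^ 2 * (qh ^ 2) ^ (n + 1) - 1 ≠ 0 := fun h0 => hne (by linear_combination -h0)
    have hc : th * (th + shiftCoeff qh th (n + 1)) = symCoeff qh th (n + 1) := by
      unfold shiftCoeff symCoeff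
      rw [← neg_sub (th ^ 2 * (qh ^ 2) ^ (n + 1)) 1]
      generalize (qh ^ 2) ^ (n + 1) = Q at *
      field_simp
      ring
    rw [elecE_neg h, elecNeg_succ, map_smul, map_add, map_smul, symmetrizer_opT1 ht, ← add_smul,
      smul_smul, hc, ← elecE_succ h, symmetrizer_elecE_succ h]

theorem elecE_succ_eq_T_mul (h : Generic qh th) (n : ℕ) :
    elecE qh th ((n : ℤ) + 1) = th⁻¹ • (T 1 * opT1 th (elecE qh th (-(n : ℤ)))) := by
  have ht := h.th_ne
  rw [elecE_succ h, elecE_neg h, opT1_eq_of_opY_eq h.qh_ne (opY_elecNeg h n), elecPos,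
    mul_smul_comm, smul_smul, inv_mul_cancel_left₀ ht]

theorem elecE_neg_eq_T_mul (h : Generic qh th) (n : ℕ) :
    elecE qh th (-(n : ℤ)) = th • (T 1 * opT1 th (elecE qh th ((n : ℤ) + 1))) := by
  have ht := h.th_ne
  have hq := h.qh_ne
  rw [elecE_succ h, elecE_neg h, opT1_eq_of_opY_eq hq (opY_elecPos h n), elecPos, map_smul,
    opTpi_T_mul hq, opTpi_opTpi hq]
  simp only [mul_smul_comm, smul_smul, ← mul_assoc, T_one_mul_T_neg_one, one_mul]
  rw [show th * th⁻¹ * (qh ^ (n + 1))⁻¹ * qh ^ n * qh ^ (1 : ℤ) = 1 by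
    rw [zpow_one]; field_simp; ring, one_smul]

/-- As `T₁ P_n = t^{1/2} P_n`, multiplication by `X` acts on `P_n` as `t^{-1/2} X T₁`, and the
involution `X T₁` exchanges `E_{-k}` and `E_{k+1}` up to scalars. -/
theorem T_mul_bosP (h : Generic qh th) (n : ℕ) :
    T 1 * bosP qh th n
      = elecE qh th ((n : ℤ) + 1) + mulXCoeff qh th n • elecE qh th (1 - (n : ℤ)) := by
  have ht := h.th_ne
  have h1 : T 1 * bosP qh th n = th⁻¹ • (T 1 * opT1 th (bosP qh th n)) := by
    rw [opT1_bosP h, mul_smul_comm, smul_smul, inv_mul_cancel₀ ht, one_smul]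
  rw [h1, bosP_eq, map_add, map_smul, mul_add, smul_add, ← elecE_succ_eq_T_mul h]
  congr 1
  cases n with
  | zero => simp [bosCoeff_eq, mulXCoeff_zero]
  | succ n =>
    rw [show (1 : ℤ) - (n + 1 : ℕ) = -(n : ℤ) by push_cast; ring, elecE_neg_eq_T_mul h n]
    push_cast
    rw [mul_smul_comm, smul_smul, smul_smul, bosCoeff_eq]
    congr 1
    field_simp

end Symmetrization

/-! ### Relations between the coefficients -/

section Coefficients

variable {F : Type*} [Field F]

theorem qPoch_succ (q z : F) (n : ℕ) : qPoch q z (n + 1) = qPoch q z n * (1 - z * q ^ n) :=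
  Finset.prod_range_succ _ _

theorem qPoch_succ' (q z : F) (n : ℕ) :
    qPoch q z (n + 1) = (1 - z) * qPoch q (z * q) n := by
  rw [qPoch, Finset.prod_range_succ', qPoch, mul_comm]
  simp only [pow_zero, mul_one, pow_succ', mul_assoc]

theorem one_sub_mul_qPoch (q z : F) (n : ℕ) :
    (1 - z) * qPoch q (z * q) n = qPoch q z n * (1 - z * q ^ n) := by
  rw [← qPoch_succ', qPoch_succ]

theorem qPoch_ne_zero {q z : F} {n : ℕ} (h : ∀ i : ℕ, i < n → 1 - z * q ^ i ≠ 0) :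
    qPoch q z n ≠ 0 :=
  Finset.prod_ne_zero_iff.mpr fun i hi => h i (Finset.mem_range.mp hi)

theorem qPoch_mul_zpow_ne_zero {q z : F} (hq : q ≠ 0) (h : ∀ k : ℤ, 1 - z * q ^ k ≠ 0) (k : ℤ)
    (n : ℕ) : qPoch q (z * q ^ k) n ≠ 0 := by
  refine qPoch_ne_zero fun i _ => ?_
  rw [mul_assoc, ← zpow_natCast, ← zpow_add₀ hq]
  exact h _

theorem qtBinom_comm (q t : F) (i j : ℕ) : qtBinom q t (i + j) i = qtBinom q t (i + j) j := by
  rw [qtBinom, qtBinom, Nat.add_sub_cancel_left, Nat.add_sub_cancel, mul_comm]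

/-- Nonvanishing conditions for the denominators of the coefficients; `w` stands for `Y^{-2}`. -/
structure Regular (q t w : F) : Prop where
  q_ne : q ≠ 0
  t_ne : t ≠ 0
  one_sub_q : ∀ n : ℕ, n ≠ 0 → 1 - q ^ n ≠ 0
  one_sub_t : ∀ k : ℤ, 1 - t * q ^ k ≠ 0
  one_sub_w : ∀ k : ℤ, 1 - w * q ^ k ≠ 0
  one_sub_tw : ∀ k : ℤ, 1 - t * w * q ^ k ≠ 0

namespace Regular

variable {q t Y w : F}

theorem qPoch_q_ne (h : Regular q t w) (n : ℕ) : qPoch q q n ≠ 0 :=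
  qPoch_ne_zero fun i _ => by
    rw [← pow_succ']
    exact h.one_sub_q _ (Nat.succ_ne_zero i)

theorem one_sub_t_pow (h : Regular q t w) (n : ℕ) : 1 - t * q ^ n ≠ 0 := by
  simpa using h.one_sub_t n

theorem qPoch_t_ne (h : Regular q t w) (n : ℕ) : qPoch q t n ≠ 0 :=
  qPoch_ne_zero fun i _ => h.one_sub_t_pow i

theorem qtBinom_succ_left (h : Regular q t w) (i j : ℕ) :
    qtBinom q t (i + j + 1) j * ((1 - q ^ (i + 1)) / (1 - q ^ (i + j + 1)))
      = qtBinom q t (i + j) j * ((1 - t * q ^ i) / (1 - t * q ^ (i + j))) := by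
  have h1 := h.qPoch_q_ne
  have h2 := h.qPoch_t_ne
  have h3 := h.one_sub_t_pow i
  have h4 := h.one_sub_t_pow (i + j)
  have h5 := h.one_sub_q (i + 1) (Nat.succ_ne_zero _)
  have h6 := h.one_sub_q (i + j + 1) (Nat.succ_ne_zero _)
  have e1 := h1 i
  have e2 := h1 j
  have e3 := h1 (i + j)
  have e4 := h2 i
  have e5 := h2 j
  have e6 := h2 (i + j)
  rw [qtBinom, qtBinom, show i + j + 1 - j = i + 1 by omega, Nat.add_sub_cancel, qPoch_succ,
    qPoch_succ, qPoch_succ, qPoch_succ, ← pow_succ', ← pow_succ']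
  field_simp

theorem qtBinom_succ_right (h : Regular q t w) (i j : ℕ) :
    qtBinom q t (i + j + 1) i * ((1 - q ^ (j + 1)) / (1 - q ^ (i + j + 1)))
      = qtBinom q t (i + j) j * ((1 - t * q ^ j) / (1 - t * q ^ (i + j))) := by
  have := h.qtBinom_succ_left j i
  rwa [add_comm j i, qtBinom_comm] at this

theorem zpow_sub_eq (h : Regular q t w) (i j : ℕ) : q ^ ((i : ℤ) - j) = q ^ i / q ^ j := by
  rw [zpow_sub₀ h.q_ne, zpow_natCast, zpow_natCast]

theorem one_sub_w_pow_div (h : Regular q t w) (i j : ℕ) : 1 - w * (q ^ i / q ^ j) ≠ 0 := by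
  rw [← h.zpow_sub_eq]
  exact h.one_sub_w _

theorem one_sub_tw_pow_div (h : Regular q t w) (i j : ℕ) :
    1 - t * w * (q ^ i / q ^ j) ≠ 0 := by
  rw [← h.zpow_sub_eq]
  exact h.one_sub_tw _

/-! ### The coefficients A and B as multiples of C -/

theorem formC_eq (h : Regular q t (Y ^ (-2 : ℤ))) (i j : ℕ) :
    formC q t Y (i + j) j = qtBinom q t (i + j) j *
      ((qPoch q (t⁻¹ * Y ^ (-2 : ℤ) * q ^ (-((j : ℤ) - 1))) j *
        qPoch q (t * Y ^ (-2 : ℤ) * q ^ ((i : ℤ) - j)) j) /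
      (qPoch q (Y ^ (-2 : ℤ) * q ^ ((i : ℤ) - j) * q) j *
        qPoch q (Y ^ (-2 : ℤ) * q ^ (-(j : ℤ))) j)) := by
  rw [formC, show ((i + j : ℕ) : ℤ) - 2 * j = (i : ℤ) - j by push_cast; ring,
    zpow_add_one₀ h.q_ne, mul_assoc _ _ q]

theorem formA_eq (h : Regular q t (Y ^ (-2 : ℤ))) (i j : ℕ) :
    formA q t Y (i + j) j = formC q t Y (i + j) j *
      ((1 - q ^ i) / (1 - q ^ (i + j)) *
        ((1 - Y ^ (-2 : ℤ) * q ^ i) / (1 - Y ^ (-2 : ℤ) * (q ^ i / q ^ j)))) := by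
  have h1 := qPoch_mul_zpow_ne_zero h.q_ne h.one_sub_w
  have e1 := h1 ((i : ℤ) - j) j
  have e2 := h1 ((i : ℤ) - j + 1) j
  have e3 := h1 (-(j : ℤ)) j
  have e4 := h.one_sub_w_pow_div i j
  have hs := one_sub_mul_qPoch q (Y ^ (-2 : ℤ) * q ^ ((i : ℤ) - j)) j
  rw [zpow_add_one₀ h.q_ne, ← mul_assoc] at e2
  rw [formC_eq h, formA, show ((i + j : ℕ) : ℤ) - 2 * j = (i : ℤ) - j by push_cast; ring,
    Nat.add_sub_cancel]
  rw [show Y ^ (-2 : ℤ) * q ^ ((i : ℤ) - j) * q ^ j = Y ^ (-2 : ℤ) * q ^ i by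
    rw [h.zpow_sub_eq]; have := h.q_ne; field_simp] at hs
  rw [← h.zpow_sub_eq] at e4 ⊢
  generalize qPoch q (Y ^ (-2 : ℤ) * q ^ ((i : ℤ) - j)) j = Z1 at *
  generalize qPoch q (Y ^ (-2 : ℤ) * q ^ ((i : ℤ) - j) * q) j = Z2 at *
  generalize qPoch q (Y ^ (-2 : ℤ) * q ^ (-(j : ℤ))) j = Z3 at *
  generalize Y ^ (-2 : ℤ) * q ^ ((i : ℤ) - j) = z at *
  have e5 : (1 - Y ^ (-2 : ℤ) * q ^ i) / (1 - z) = Z2 / Z1 := by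
    rw [div_eq_div_iff e4 e1]
    linear_combination -hs
  rw [e5]
  field_simp

theorem formB_eq (h : Regular q t (Y ^ (-2 : ℤ))) (i j : ℕ) :
    formB q t Y (i + j) i = formC q t Y (i + j) j *
      (q ^ i * ((1 - q ^ j) / (1 - q ^ (i + j))) *
        ((1 - Y ^ (-2 : ℤ) / q ^ j) / (1 - t * Y ^ (-2 : ℤ) * (q ^ i / q ^ j)))) := by
  -- For `j = 0` both sides vanish through `1 - q^0`; otherwise one leading factor is split off two
  -- of the Pochhammer products of `C`.
  cases j with
  | zero => simp [formB]
  | succ j =>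
    have h1 := qPoch_mul_zpow_ne_zero h.q_ne h.one_sub_w
    have h2 := qPoch_mul_zpow_ne_zero h.q_ne h.one_sub_tw
    have e1 := h1 ((i : ℤ) - (j + 1 : ℕ) + 1) (j + 1)
    have e2 := h1 (-((j + 1 : ℕ) : ℤ) + 1) j
    have e3 := h.one_sub_tw_pow_div i (j + 1)
    have e4 := h.one_sub_w (-((j + 1 : ℕ) : ℤ))
    have hd : Y ^ (-2 : ℤ) / q ^ (j + 1) = Y ^ (-2 : ℤ) * q ^ (-((j + 1 : ℕ) : ℤ)) := by
      rw [zpow_neg q, zpow_natCast, div_eq_mul_inv]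
    rw [formC_eq h, formB, show ((i + (j + 1) : ℕ) : ℤ) - i - 1 = ((j + 1 : ℕ) : ℤ) - 1 by
      push_cast; ring,
      show -(((i + (j + 1) : ℕ) : ℤ) - 2 * i - 1) = (i : ℤ) - (j + 1 : ℕ) + 1 by push_cast; ring,
      show -(((j + 1 : ℕ) : ℤ) - 1) = -((j + 1 : ℕ) : ℤ) + 1 by ring,
      Nat.add_sub_cancel_left, Nat.add_sub_cancel, qtBinom_comm, hd,
      qPoch_succ' q (t * Y ^ (-2 : ℤ) * q ^ ((i : ℤ) - (j + 1 : ℕ))) j,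
      qPoch_succ' q (Y ^ (-2 : ℤ) * q ^ (-((j + 1 : ℕ) : ℤ))) j, ← h.zpow_sub_eq]
    rw [← h.zpow_sub_eq] at e3
    simp only [zpow_add_one₀ h.q_ne, ← mul_assoc] at e1 e2 ⊢
    generalize qPoch q (t⁻¹ * Y ^ (-2 : ℤ) * q ^ (-((j + 1 : ℕ) : ℤ)) * q) (j + 1) = Z1
    generalize qPoch q (t * Y ^ (-2 : ℤ) * q ^ ((i : ℤ) - (j + 1 : ℕ)) * q) j = Z2
    generalize qPoch q (Y ^ (-2 : ℤ) * q ^ ((i : ℤ) - (j + 1 : ℕ)) * q) (j + 1) = Z3 at *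
    generalize qPoch q (Y ^ (-2 : ℤ) * q ^ (-((j + 1 : ℕ) : ℤ)) * q) j = Z4 at *
    generalize Y ^ (-2 : ℤ) * q ^ (-((j + 1 : ℕ) : ℤ)) = z at *
    generalize t * Y ^ (-2 : ℤ) * q ^ ((i : ℤ) - (j + 1 : ℕ)) = z' at *
    generalize (1 - q ^ (j + 1)) / (1 - q ^ (i + (j + 1))) = c
    field_simp

theorem formA_succ_eq (h : Regular q t (Y ^ (-2 : ℤ))) (i j : ℕ) :
    formA q t Y (i + j + 1) j = formC q t Y (i + j) j *
      ((1 - t * q ^ i) / (1 - t * q ^ (i + j)) *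
        ((1 - t * Y ^ (-2 : ℤ) * q ^ i) / (1 - t * Y ^ (-2 : ℤ) * (q ^ i / q ^ j)))) := by
  have h1 := qPoch_mul_zpow_ne_zero h.q_ne h.one_sub_w
  have e1 := h1 ((i : ℤ) - j + 1) j
  have e2 := h1 (-(j : ℤ)) j
  have e3 := h.one_sub_tw_pow_div i j
  have hs := one_sub_mul_qPoch q (t * Y ^ (-2 : ℤ) * q ^ ((i : ℤ) - j)) j
  rw [show t * Y ^ (-2 : ℤ) * q ^ ((i : ℤ) - j) * q ^ j = t * Y ^ (-2 : ℤ) * q ^ i by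
    rw [h.zpow_sub_eq]; have := h.q_ne; field_simp] at hs
  rw [formC_eq h, formA, show ((i + j + 1 : ℕ) : ℤ) - 2 * j = (i : ℤ) - j + 1 by push_cast; ring,
    show i + j + 1 - j = i + 1 by omega, h.qtBinom_succ_left]
  rw [← h.zpow_sub_eq] at e3 ⊢
  simp only [zpow_add_one₀ h.q_ne, ← mul_assoc] at e1 hs ⊢
  generalize qPoch q (t * Y ^ (-2 : ℤ) * q ^ ((i : ℤ) - j)) j = Z1 at *
  generalize qPoch q (t * Y ^ (-2 : ℤ) * q ^ ((i : ℤ) - j) * q) j = Z2 at *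
  generalize qPoch q (Y ^ (-2 : ℤ) * q ^ ((i : ℤ) - j) * q) j = Z3 at *
  generalize qPoch q (Y ^ (-2 : ℤ) * q ^ (-(j : ℤ))) j = Z4 at *
  generalize t * Y ^ (-2 : ℤ) * q ^ ((i : ℤ) - j) = z at *
  generalize (1 - t * q ^ i) / (1 - t * q ^ (i + j)) = c
  generalize 1 - t * Y ^ (-2 : ℤ) * q ^ i = d at *
  generalize qPoch q (t⁻¹ * Y ^ (-2 : ℤ) * q ^ (-((j : ℤ) - 1))) j = Z5
  generalize qtBinom q t (i + j) j = e
  field_simp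
  linear_combination e * c * Z5 * hs

theorem formB_succ_eq (h : Regular q t (Y ^ (-2 : ℤ))) (i j : ℕ) :
    formB q t Y (i + j + 1) i = formC q t Y (i + j) j *
      (q ^ i * ((1 - t * q ^ j) / (1 - t * q ^ (i + j))) *
        ((1 - t⁻¹ * Y ^ (-2 : ℤ) / q ^ j) / (1 - Y ^ (-2 : ℤ) * (q ^ i / q ^ j)))) := by
  have h1 := qPoch_mul_zpow_ne_zero h.q_ne h.one_sub_w
  have e1 := h1 ((i : ℤ) - j + 1) j
  have e2 := h1 (-(j : ℤ)) j
  have e3 := h.one_sub_w_pow_div i j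
  have hd : t⁻¹ * Y ^ (-2 : ℤ) / q ^ j = t⁻¹ * Y ^ (-2 : ℤ) * q ^ (-(j : ℤ)) := by
    rw [zpow_neg q, zpow_natCast, div_eq_mul_inv]
  rw [formC_eq h, formB, show ((i + j + 1 : ℕ) : ℤ) - i - 1 = j by push_cast; ring,
    show -(((i + j + 1 : ℕ) : ℤ) - 2 * i - 1) = (i : ℤ) - j by push_cast; ring,
    show i + j + 1 - i = j + 1 by omega, Nat.add_sub_cancel, mul_assoc (q ^ i),
    h.qtBinom_succ_right, hd, show -((j : ℤ) - 1) = -(j : ℤ) + 1 by ring, qPoch_succ', qPoch_succ',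
    ← h.zpow_sub_eq]
  rw [← h.zpow_sub_eq] at e3
  simp only [zpow_add_one₀ h.q_ne, ← mul_assoc] at e1 ⊢
  generalize qPoch q (t⁻¹ * Y ^ (-2 : ℤ) * q ^ (-(j : ℤ)) * q) j = Z1 at *
  generalize qPoch q (t * Y ^ (-2 : ℤ) * q ^ ((i : ℤ) - j)) j = Z2 at *
  generalize qPoch q (Y ^ (-2 : ℤ) * q ^ ((i : ℤ) - j) * q) j = Z3 at *
  generalize qPoch q (Y ^ (-2 : ℤ) * q ^ (-(j : ℤ))) j = Z4 at *
  generalize t⁻¹ * Y ^ (-2 : ℤ) * q ^ (-(j : ℤ)) = z at *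
  generalize Y ^ (-2 : ℤ) * q ^ ((i : ℤ) - j) = z' at *
  generalize (1 - t * q ^ j) / (1 - t * q ^ (i + j)) = c
  field_simp

/-! ### The linear relations behind the induction -/

theorem formA_succ_eq_sub (h : Regular q t (Y ^ (-2 : ℤ))) (i j : ℕ) :
    formA q t Y (i + j + 1) j = formC q t Y (i + j) j
      - t * ((1 - q ^ (i + j)) / (1 - t * q ^ (i + j))) * formB q t Y (i + j) i := by
  have h1 := h.one_sub_t_pow (i + j)
  have h2 := h.one_sub_tw_pow_div i j
  have hj : q ^ j ≠ 0 := pow_ne_zero _ h.q_ne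
  rw [h.formA_succ_eq, h.formB_eq]
  generalize formC q t Y (i + j) j = c
  generalize Y ^ (-2 : ℤ) = w at *
  -- At level `0` the denominator `1 - q^{i+j}` inside `B` is zero, so cancelling it against the
  -- prefactor is not allowed.
  rcases eq_or_ne (i + j) 0 with h0 | h0
  · obtain ⟨rfl, rfl⟩ : i = 0 ∧ j = 0 := by omega
    simp only [add_zero, pow_zero, mul_one, div_one] at *
    rw [div_self h1, div_self h2]
    simp
  · have h3 := h.one_sub_q _ h0
    rw [pow_add] at *
    -- With `x = q^{i-j}` and `b = q^j` one has `q^i = x b`, and an identity of rational functions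
    -- in `x, b, t, w` remains.
    generalize hx : q ^ i / q ^ j = x at *
    rw [div_eq_iff hj] at hx
    rw [hx] at h1 h3 ⊢
    generalize q ^ j = b at *
    generalize hD₁ : 1 - t * (x * b * b) = D₁ at *
    generalize hD₂ : 1 - t * w * x = D₂ at *
    generalize hD₃ : 1 - x * b * b = D₃ at *
    field_simp
    subst hD₁ hD₂ hD₃
    ring

theorem formB_succ_eq_sub (h : Regular q t (Y ^ (-2 : ℤ))) (i j : ℕ) :
    formB q t Y (i + j + 1) i
      = formC q t Y (i + j) j *
          ((1 - t⁻¹ * Y ^ (-2 : ℤ) * (q ^ i / q ^ j)) / (1 - Y ^ (-2 : ℤ) * (q ^ i / q ^ j)))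
        - (1 - q ^ (i + j)) / (1 - t * q ^ (i + j)) * formA q t Y (i + j) j := by
  have h1 := h.one_sub_t_pow (i + j)
  have h2 := h.one_sub_w_pow_div i j
  have ht := h.t_ne
  have hj : q ^ j ≠ 0 := pow_ne_zero _ h.q_ne
  rw [h.formB_succ_eq, h.formA_eq]
  generalize formC q t Y (i + j) j = c
  generalize Y ^ (-2 : ℤ) = w at *
  rcases eq_or_ne (i + j) 0 with h0 | h0
  · obtain ⟨rfl, rfl⟩ : i = 0 ∧ j = 0 := by omega
    simp only [add_zero, pow_zero, mul_one, div_one] at *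
    rw [div_self h1]
    simp
  · have h3 := h.one_sub_q _ h0
    rw [pow_add] at *
    generalize hx : q ^ i / q ^ j = x at *
    rw [div_eq_iff hj] at hx
    rw [hx] at h1 h3 ⊢
    generalize q ^ j = b at *
    generalize hD₁ : 1 - t * (x * b * b) = D₁ at *
    generalize hD₂ : 1 - w * x = D₂ at *
    generalize hD₃ : 1 - x * b * b = D₃ at *
    field_simp
    subst hD₁ hD₂ hD₃
    ring

theorem formC_eq_add (h : Regular q t (Y ^ (-2 : ℤ))) {i j : ℕ} (hij : i + j ≠ 0) :
    formC q t Y (i + j) j = formA q t Y (i + j) j + formB q t Y (i + j) i *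
      ((1 - t * Y ^ (-2 : ℤ) * (q ^ i / q ^ j)) / (1 - Y ^ (-2 : ℤ) * (q ^ i / q ^ j))) := by
  have h1 := h.one_sub_w_pow_div i j
  have h2 := h.one_sub_tw_pow_div i j
  have hj : q ^ j ≠ 0 := pow_ne_zero _ h.q_ne
  have h3 := h.one_sub_q _ hij
  rw [h.formA_eq, h.formB_eq]
  generalize formC q t Y (i + j) j = c
  generalize Y ^ (-2 : ℤ) = w at *
  rw [pow_add] at *
  generalize hx : q ^ i / q ^ j = x at *
  rw [div_eq_iff hj] at hx
  rw [hx] at h3 ⊢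
  generalize q ^ j = b at *
  generalize hD₁ : 1 - w * x = D₁ at *
  generalize hD₂ : 1 - t * w * x = D₂ at *
  generalize hD₃ : 1 - x * b * b = D₃ at *
  field_simp
  subst hD₁ hD₂ hD₃
  ring

/-- The factor of index `j - 1 - m` in the first Pochhammer product is `1 - q^0`. -/
theorem formC_eq_zero {m i j : ℕ} (h : Regular q t (Y ^ (-2 : ℤ)))
    (hY : Y ^ (-2 : ℤ) = t * q ^ m) (hmj : m < j) : formC q t Y (i + j) j = 0 := by
  have h0 : qPoch q (t⁻¹ * Y ^ (-2 : ℤ) * q ^ (-((j : ℤ) - 1))) j = 0 := by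
    refine Finset.prod_eq_zero (Finset.mem_range.mpr (show j - 1 - m < j by omega)) ?_
    rw [hY, inv_mul_cancel_left₀ h.t_ne, ← zpow_natCast, ← zpow_natCast, ← zpow_add₀ h.q_ne,
      ← zpow_add₀ h.q_ne, show (m : ℤ) + -((j : ℤ) - 1) + ((j - 1 - m : ℕ) : ℤ) = 0 by omega,
      zpow_zero, sub_self]
  rw [formC, h0]
  simp

end Regular

end Coefficients

/-! ### Evaluation of rational functions -/

section Evaluation

variable {K : Type*} [Field K]

/-- `f` is defined at `y` and has the value `c` there. -/
def HasEval (y : K) (f : RatFunc K) (c : K) : Prop :=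
  ∃ p d : Polynomial K, d.eval y ≠ 0 ∧
    f = algebraMap _ (RatFunc K) p / algebraMap _ (RatFunc K) d ∧ c = p.eval y / d.eval y

namespace HasEval

variable {y c c' : K} {f g : RatFunc K}

theorem algebraMap_ne_zero {d : Polynomial K} (hd : d.eval y ≠ 0) :
    algebraMap _ (RatFunc K) d ≠ 0 := by
  refine RatFunc.algebraMap_ne_zero ?_
  rintro rfl
  simp at hd

/-- The denominator in lowest terms divides that of any other representation. -/
theorem denom_eval_ne_zero (h : HasEval y f c) : f.denom.eval y ≠ 0 := by
  obtain ⟨p, d, hd, rfl, -⟩ := h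
  obtain ⟨e, he⟩ := RatFunc.denom_div_dvd p d
  intro h0
  apply hd
  conv_lhs => rw [he]
  rw [Polynomial.eval_mul, h0, zero_mul]

theorem eval_eq (h : HasEval y f c) : f.eval (RingHom.id K) y = c := by
  have h1 := h.denom_eval_ne_zero
  obtain ⟨p, d, hd, hf, rfl⟩ := h
  have h2 : f.num * d = p * f.denom := by
    apply RatFunc.algebraMap_injective K
    rw [map_mul, map_mul]
    have h3 := RatFunc.num_div_denom f
    conv_rhs at h3 => rw [hf]
    rwa [div_eq_div_iff (algebraMap_ne_zero h1) (algebraMap_ne_zero hd)] at h3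
  have h4 := congrArg (Polynomial.eval y) h2
  rw [Polynomial.eval_mul, Polynomial.eval_mul] at h4
  rw [RatFunc.eval, Polynomial.eval₂_id, Polynomial.eval₂_id, div_eq_div_iff h1 hd, h4]

theorem C (a : K) : HasEval y (RatFunc.C a) a :=
  ⟨Polynomial.C a, 1, by simp, by simp, by simp⟩

theorem X : HasEval y RatFunc.X y := ⟨Polynomial.X, 1, by simp, by simp, by simp⟩

theorem one : HasEval y 1 1 := by simpa using C (y := y) (1 : K)

theorem mul (hf : HasEval y f c) (hg : HasEval y g c') : HasEval y (f * g) (c * c') := by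
  obtain ⟨p, d, hd, rfl, rfl⟩ := hf
  obtain ⟨p', d', hd', rfl, rfl⟩ := hg
  refine ⟨p * p', d * d', ?_, ?_, ?_⟩
  · rw [Polynomial.eval_mul]; exact mul_ne_zero hd hd'
  · rw [map_mul, map_mul, div_mul_div_comm]
  · rw [Polynomial.eval_mul, Polynomial.eval_mul, div_mul_div_comm]

theorem sub (hf : HasEval y f c) (hg : HasEval y g c') : HasEval y (f - g) (c - c') := by
  obtain ⟨p, d, hd, rfl, rfl⟩ := hf
  obtain ⟨p', d', hd', rfl, rfl⟩ := hg
  refine ⟨p * d' - d * p', d * d', ?_, ?_, ?_⟩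
  · rw [Polynomial.eval_mul]; exact mul_ne_zero hd hd'
  · rw [map_sub, map_mul, map_mul, map_mul,
      div_sub_div _ _ (algebraMap_ne_zero hd) (algebraMap_ne_zero hd')]
  · rw [Polynomial.eval_sub, Polynomial.eval_mul, Polynomial.eval_mul, Polynomial.eval_mul,
      div_sub_div _ _ hd hd']

theorem inv (hf : HasEval y f c) (hc : c ≠ 0) : HasEval y f⁻¹ c⁻¹ := by
  obtain ⟨p, d, hd, rfl, rfl⟩ := hf
  exact ⟨d, p, (div_ne_zero_iff.mp hc).1, inv_div _ _, inv_div _ _⟩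

theorem div (hf : HasEval y f c) (hg : HasEval y g c') (hc : c' ≠ 0) :
    HasEval y (f / g) (c / c') := by
  rw [div_eq_mul_inv, div_eq_mul_inv]
  exact hf.mul (hg.inv hc)

theorem pow (hf : HasEval y f c) (n : ℕ) : HasEval y (f ^ n) (c ^ n) := by
  induction n with
  | zero => simpa using one
  | succ n ih => rw [pow_succ, pow_succ]; exact ih.mul hf

theorem zpow (hf : HasEval y f c) (hc : c ≠ 0) (n : ℤ) : HasEval y (f ^ n) (c ^ n) := by
  cases n with
  | ofNat n => simpa using hf.pow n
  | negSucc n =>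
    rw [zpow_negSucc, zpow_negSucc]
    exact (hf.pow _).inv (pow_ne_zero _ hc)

theorem qPoch (hf : HasEval y f c) (hg : HasEval y g c') (n : ℕ) :
    HasEval y (qPoch f g n) (qPoch c c' n) := by
  induction n with
  | zero => simpa [SL2Macdonald.qPoch] using one
  | succ n ih =>
    rw [qPoch_succ, qPoch_succ]
    exact ih.mul (one.sub (hg.mul (hf.pow n)))

variable {q t : K}

theorem qtBinom (h : Regular q t (y ^ (-2 : ℤ))) (l j : ℕ) :
    HasEval y (qtBinom (RatFunc.C q) (RatFunc.C t) l j) (qtBinom q t l j) := by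
  have h1 := h.qPoch_q_ne
  have h2 := h.qPoch_t_ne
  have h3 := fun n => ((C (y := y) q).qPoch (C q) n).div ((C q).qPoch (C t) n) (h2 n)
  exact (h3 l).div ((h3 j).mul (h3 (l - j)))
    (mul_ne_zero (div_ne_zero (h1 _) (h2 _)) (div_ne_zero (h1 _) (h2 _)))

theorem coefC (h : Regular q t (y ^ (-2 : ℤ))) (hy : y ≠ 0) (l j : ℕ) :
    HasEval y (coefC q t l j) (formC q t y l j) := by
  have hW := X.zpow hy (-2)
  have hq := (C (y := y) q).zpow h.q_ne
  have ht := C (y := y) t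
  have h1 := qPoch_mul_zpow_ne_zero h.q_ne h.one_sub_w
  exact (qtBinom h l j).mul
    ((((C q).qPoch (((ht.inv h.t_ne).mul hW).mul (hq _)) j).mul
      ((C q).qPoch ((ht.mul hW).mul (hq _)) j)).div
      (((C q).qPoch (hW.mul (hq _)) j).mul ((C q).qPoch (hW.mul (hq _)) j))
      (mul_ne_zero (h1 _ _) (h1 _ _)))

theorem coefA (h : Regular q t (y ^ (-2 : ℤ))) (hy : y ≠ 0) {l : ℕ} (hl : l ≠ 0) (j : ℕ) :
    HasEval y (coefA q t l j) (formA q t y l j) := by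
  have hW := X.zpow hy (-2)
  have hq := (C (y := y) q).zpow h.q_ne
  have ht := C (y := y) t
  have h1 := qPoch_mul_zpow_ne_zero h.q_ne h.one_sub_w
  exact ((qtBinom h l j).mul ((one.sub ((C q).pow _)).div (one.sub ((C q).pow _))
      (h.one_sub_q l hl))).mul
    ((((C q).qPoch (((ht.inv h.t_ne).mul hW).mul (hq _)) j).mul
      ((C q).qPoch ((ht.mul hW).mul (hq _)) j)).div
      (((C q).qPoch (hW.mul (hq _)) j).mul ((C q).qPoch (hW.mul (hq _)) j))
      (mul_ne_zero (h1 _ _) (h1 _ _)))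

theorem coefB (h : Regular q t (y ^ (-2 : ℤ))) (hy : y ≠ 0) {l : ℕ} (hl : l ≠ 0) (j : ℕ) :
    HasEval y (coefB q t l j) (formB q t y l j) := by
  have hW := X.zpow hy (-2)
  have hq := (C (y := y) q).zpow h.q_ne
  have ht := C (y := y) t
  have h1 := qPoch_mul_zpow_ne_zero h.q_ne h.one_sub_w
  exact ((((C q).pow j).mul (qtBinom h l j)).mul
      ((one.sub ((C q).pow _)).div (one.sub ((C q).pow _)) (h.one_sub_q l hl))).mul
    ((((C q).qPoch (((ht.inv h.t_ne).mul hW).mul (hq _)) _).mul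
      ((C q).qPoch ((ht.mul hW).mul (hq _)) _)).div
      (((C q).qPoch (hW.mul (hq _)) _).mul ((C q).qPoch (hW.mul (hq _)) _))
      (mul_ne_zero (h1 _ _) (h1 _ _)))

end HasEval

end Evaluation

/-! ### The product rules -/

section ProductRules

open LaurentPolynomial

variable {K : Type*} [Field K] {qh th : K}

/-- The value of `C_j^{(ℓ)}` under `ev_m`. -/
def valC (qh th : K) (m l j : ℕ) : K := formC (qh ^ 2) (th ^ 2) (evPoint qh th m) l j

/-- The value of `A_j^{(ℓ)}` under `ev_m`. -/
def valA (qh th : K) (m l j : ℕ) : K := formA (qh ^ 2) (th ^ 2) (evPoint qh th m) l j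

/-- The value of `B_j^{(ℓ)}` under `ev_m`. -/
def valB (qh th : K) (m l j : ℕ) : K := formB (qh ^ 2) (th ^ 2) (evPoint qh th m) l j

theorem evPoint_ne_zero (h : Generic qh th) (m : ℕ) : evPoint qh th m ≠ 0 :=
  mul_ne_zero (inv_ne_zero h.th_ne) (zpow_ne_zero _ h.qh_ne)

theorem evPoint_zpow (m : ℕ) :
    evPoint qh th m ^ (-2 : ℤ) = th ^ 2 * (qh ^ 2) ^ m := by
  rw [evPoint, zpow_neg, zpow_neg, zpow_natCast, ← mul_inv, inv_zpow, inv_inv, mul_zpow]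
  rw [zpow_ofNat, zpow_ofNat, ← pow_mul, ← pow_mul, mul_comm m]

theorem regular_evPoint (h : Generic qh th) (m : ℕ) :
    Regular (qh ^ 2) (th ^ 2) (evPoint qh th m ^ (-2 : ℤ)) where
  q_ne := h.q_ne
  t_ne := h.t_ne
  one_sub_q _ hn := h.one_sub_q_pow_ne hn
  one_sub_t := h.one_sub_t_mul_zpow_ne
  one_sub_w k := by
    rw [evPoint_zpow, mul_assoc, ← zpow_natCast (qh ^ 2) m, ← zpow_add₀ h.q_ne]
    exact h.one_sub_t_mul_zpow_ne _
  one_sub_tw k := by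
    rw [evPoint_zpow, mul_assoc, mul_assoc, ← zpow_natCast (qh ^ 2) m, ← zpow_add₀ h.q_ne]
    exact h.one_sub_t_sq_mul_zpow_ne _

/-! ### Values at the evaluation point -/

theorem valC_eq_zero (h : Generic qh th) {m i j : ℕ} (hmj : m < j) :
    valC qh th m (i + j) j = 0 :=
  (regular_evPoint h m).formC_eq_zero (evPoint_zpow m) hmj

theorem valA_of_valC_eq_zero (h : Generic qh th) {m i j : ℕ} (hC : valC qh th m (i + j) j = 0) :
    valA qh th m (i + j) j = 0 := by
  rw [valA, (regular_evPoint h m).formA_eq, ← valC, hC, zero_mul]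

theorem valB_of_valC_eq_zero (h : Generic qh th) {m i j : ℕ} (hC : valC qh th m (i + j) j = 0) :
    valB qh th m (i + j) i = 0 := by
  rw [valB, (regular_evPoint h m).formB_eq, ← valC, hC, zero_mul]

theorem valA_self (m l : ℕ) : valA qh th m l l = 0 := by simp [valA, formA]

theorem valB_self (m l : ℕ) : valB qh th m l l = 0 := by simp [valB, formB]

theorem valC_zero_zero (m : ℕ) : valC qh th m 0 0 = 1 := by
  simp [valC, formC, qPoch, qtBinom]

theorem valA_succ (h : Generic qh th) (m i j : ℕ) :
    valA qh th m (i + j + 1) j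
      = valC qh th m (i + j) j - bosCoeff qh th (i + j) * valB qh th m (i + j) i := by
  rw [bosCoeff, mul_div_assoc]
  exact (regular_evPoint h m).formA_succ_eq_sub i j

/-- At the evaluation point `Y⁻² q^{i-j} = t q^n` with `n = m + i - j`; the fractions in the
coefficient relations thereby become `mulXCoeff` and `symCoeff` at `n`. -/
theorem evPoint_mul_div (h : Generic qh th) {m i j n : ℕ} (hn : n + j = m + i) :
    (qh ^ 2) ^ m * ((qh ^ 2) ^ i / (qh ^ 2) ^ j) = (qh ^ 2) ^ n := by
  rw [← mul_div_assoc, ← pow_add, ← hn, pow_add, mul_div_cancel_right₀ _ (pow_ne_zero _ h.q_ne)]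

theorem valB_succ (h : Generic qh th) {m i j n : ℕ} (hn : n + j = m + i) :
    valB qh th m (i + j + 1) i
      = valC qh th m (i + j) j * mulXCoeff qh th n
        - mulXCoeff qh th (i + j) * valA qh th m (i + j) j := by
  have h1 := (regular_evPoint h m).formB_succ_eq_sub i j
  rw [evPoint_zpow, inv_mul_cancel_left₀ h.t_ne, mul_assoc, evPoint_mul_div h hn] at h1
  exact h1

theorem valC_eq_add (h : Generic qh th) {m i j n : ℕ} (hn : n + j = m + i) (hij : i + j ≠ 0) :
    valC qh th m (i + j) j
      = valA qh th m (i + j) j + valB qh th m (i + j) i * symCoeff qh th n := by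
  have h1 := (regular_evPoint h m).formC_eq_add hij
  rw [evPoint_zpow, mul_assoc (th ^ 2), mul_assoc (th ^ 2), evPoint_mul_div h hn] at h1
  exact h1

theorem symmetrizer_term (h : Generic qh th) (m : ℕ) {i j : ℕ} (hij : i + j ≠ 0) :
    symmetrizer th (valA qh th m (i + j) j • elecE qh th ((m : ℤ) + i - j)
        + valB qh th m (i + j) i • elecE qh th (-((m : ℤ) + i - j)))
      = valC qh th m (i + j) j • bosP qh th (m + (i + j) - 2 * j) := by
  by_cases hC : valC qh th m (i + j) j = 0
  · rw [valA_of_valC_eq_zero h hC, valB_of_valC_eq_zero h hC, hC]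
    simp
  -- A nonzero `C_j` forces `j ≤ m`, so the natural-number subtraction in the index of `P` is
  -- genuine.
  have hmj : j ≤ m := not_lt.mp fun hmj => hC (valC_eq_zero h hmj)
  obtain ⟨n, hn⟩ : ∃ n, n + j = m + i := ⟨m + i - j, by omega⟩
  rw [show m + (i + j) - 2 * j = n by omega, show (m : ℤ) + i - j = n by omega, map_add, map_smul,
    map_smul, symmetrizer_elecE_neg h, valC_eq_add h hn hij, add_smul, mul_smul]
  congr 1
  cases n with
  | zero =>
    -- Symmetrizing `E_0` does not give `P_0` with coefficient `1`, but here `i = 0`, so `A_j`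
    -- vanishes and only the `B` term contributes.
    obtain rfl : i = 0 := by omega
    rw [zero_add, valA_self, zero_smul, zero_smul]
  | succ n =>
    push_cast
    rw [symmetrizer_elecE_succ h]

theorem elecE_neg_term (h : Generic qh th) (m i j : ℕ) :
    valC qh th m (i + j) j • bosP qh th (m + (i + j) - 2 * j)
        - bosCoeff qh th (i + j) •
          (valA qh th m (i + j) j • elecE qh th ((m : ℤ) + i - j)
            + valB qh th m (i + j) i • elecE qh th (-((m : ℤ) + i - j)))
      = (th ^ 2 * valB qh th m (i + j + 1) i) • elecE qh th ((m : ℤ) + i - j)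
        + valA qh th m (i + j + 1) j • elecE qh th (-((m : ℤ) + i - j)) := by
  by_cases hC : valC qh th m (i + j) j = 0
  · have hB : valB qh th m (i + j + 1) i = 0 := by
      rw [valB, (regular_evPoint h m).formB_succ_eq, ← valC, hC, zero_mul]
    rw [valA_succ h, valA_of_valC_eq_zero h hC, valB_of_valC_eq_zero h hC, hC, hB]
    simp
  have hmj : j ≤ m := not_lt.mp fun hmj => hC (valC_eq_zero h hmj)
  obtain ⟨n, hn⟩ : ∃ n, n + j = m + i := ⟨m + i - j, by omega⟩
  rw [show m + (i + j) - 2 * j = n by omega, show (m : ℤ) + i - j = n by omega, valB_succ h hn,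
    valA_succ h, bosP_eq, bosCoeff_eq n, bosCoeff_eq (i + j)]
  module

theorem elecE_succ_term (h : Generic qh th) (m i j : ℕ) :
    valC qh th m (i + j) j • (T 1 * bosP qh th (m + (i + j) - 2 * j))
        - mulXCoeff qh th (i + j) •
          ((th ^ 2 * valB qh th m (i + j) i) • elecE qh th ((m : ℤ) + i - j + 1)
            + valA qh th m (i + j) j • elecE qh th (1 - ((m : ℤ) + i - j)))
      = valA qh th m (i + j + 1) j • elecE qh th ((m : ℤ) + i - j + 1)
        + valB qh th m (i + j + 1) i • elecE qh th (1 - ((m : ℤ) + i - j)) := by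
  by_cases hC : valC qh th m (i + j) j = 0
  · have hB : valB qh th m (i + j + 1) i = 0 := by
      rw [valB, (regular_evPoint h m).formB_succ_eq, ← valC, hC, zero_mul]
    rw [valA_succ h, valA_of_valC_eq_zero h hC, valB_of_valC_eq_zero h hC, hC, hB]
    simp
  have hmj : j ≤ m := not_lt.mp fun hmj => hC (valC_eq_zero h hmj)
  obtain ⟨n, hn⟩ : ∃ n, n + j = m + i := ⟨m + i - j, by omega⟩
  rw [show m + (i + j) - 2 * j = n by omega, show (m : ℤ) + i - j = n by omega, valB_succ h hn,
    valA_succ h, T_mul_bosP h, bosCoeff_eq (i + j)]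
  module

/-- `P_ℓ P_m` as a linear combination of bosonic Macdonald polynomials. -/
def BosRule (qh th : K) (m l : ℕ) : Prop :=
  bosP qh th l * bosP qh th m
    = ∑ j ∈ Finset.range (l + 1), valC qh th m l j • bosP qh th (m + l - 2 * j)

/-- `E_ℓ P_m` as a linear combination of electronic Macdonald polynomials. -/
def PosRule (qh th : K) (m l : ℕ) : Prop :=
  elecE qh th l * bosP qh th m
    = ∑ j ∈ Finset.range (l + 1), (valA qh th m l j • elecE qh th ((m : ℤ) + l - 2 * j)
        + valB qh th m l (l - j) • elecE qh th (-((m : ℤ) + l - 2 * j)))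

/-- `E_{-ℓ} P_m` as a linear combination of electronic Macdonald polynomials. -/
def NegRule (qh th : K) (m l : ℕ) : Prop :=
  elecE qh th (-(l : ℤ)) * bosP qh th m
    = ∑ j ∈ Finset.range (l + 1),
        ((th ^ 2 * valB qh th m (l + 1) (l - j)) • elecE qh th ((m : ℤ) + l - 2 * j)
          + valA qh th m (l + 1) j • elecE qh th (-((m : ℤ) + l - 2 * j)))

/-! ### Induction on the degree of the first factor -/

theorem bosRule_zero (h : Generic qh th) (m : ℕ) : BosRule qh th m 0 := by
  simp [BosRule, bosP_zero h, valC_zero_zero]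

theorem bosRule_of_posRule (h : Generic qh th) {m l : ℕ} (hl : l ≠ 0)
    (hp : PosRule qh th m l) : BosRule qh th m l := by
  have h1 := congrArg (symmetrizer th) hp
  obtain ⟨k, rfl⟩ := Nat.exists_eq_add_one_of_ne_zero hl
  have hE : symmetrizer th (elecE qh th ((k + 1 : ℕ) : ℤ)) = bosP qh th (k + 1) := by
    push_cast
    exact symmetrizer_elecE_succ h k
  rw [symmetrizer_mul_of_invert_eq _ (invert_bosP h m), hE, map_sum] at h1
  rw [BosRule, h1]
  refine Finset.sum_congr rfl fun j hj => ?_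
  obtain ⟨i, hi⟩ : ∃ i, k + 1 = i + j :=
    ⟨k + 1 - j, by have := Finset.mem_range.mp hj; omega⟩
  rw [hi, Nat.add_sub_cancel, ← symmetrizer_term h m (by omega),
    show (m : ℤ) + (i + j : ℕ) - 2 * j = (m : ℤ) + i - j by push_cast; ring]

theorem negRule_of_bosRule (h : Generic qh th) {m l : ℕ} (hb : BosRule qh th m l)
    (hp : PosRule qh th m l) : NegRule qh th m l := by
  have h1 : elecE qh th (-(l : ℤ)) * bosP qh th m
      = bosP qh th l * bosP qh th m
        - bosCoeff qh th l • (elecE qh th l * bosP qh th m) := by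
    rw [bosP_eq l, add_mul, smul_mul_assoc, add_sub_cancel_right]
  rw [NegRule, h1, hb, hp, Finset.smul_sum, ← Finset.sum_sub_distrib]
  refine Finset.sum_congr rfl fun j hj => ?_
  obtain ⟨i, rfl⟩ : ∃ i, l = i + j := ⟨l - j, by have := Finset.mem_range.mp hj; omega⟩
  rw [Nat.add_sub_cancel, show (m : ℤ) + (i + j : ℕ) - 2 * j = (m : ℤ) + i - j by push_cast; ring]
  exact elecE_neg_term h m i j

/-- Realigns the negative rule at level `l - 1` with the summation range at level `l`: the added
boundary terms carry `A_l` or `B_l`, which are zero. For `l = 0` the prefactor vanishes, so no rule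
is needed. -/
theorem mulXCoeff_smul_elecE_mul (m l : ℕ) (hn : ∀ k, l = k + 1 → NegRule qh th m k) :
    mulXCoeff qh th l • (elecE qh th (1 - (l : ℤ)) * bosP qh th m)
      = ∑ j ∈ Finset.range (l + 1), mulXCoeff qh th l •
          ((th ^ 2 * valB qh th m l (l - j)) • elecE qh th ((m : ℤ) + l - 2 * j + 1)
            + valA qh th m l j • elecE qh th (1 - ((m : ℤ) + l - 2 * j))) := by
  cases l with
  | zero => simp [mulXCoeff_zero]
  | succ k =>
    rw [← Finset.smul_sum, show (1 : ℤ) - (k + 1 : ℕ) = -(k : ℤ) by push_cast; ring, hn k rfl,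
      Finset.sum_add_distrib, Finset.sum_add_distrib, Finset.sum_range_succ' _ (k + 1),
      Finset.sum_range_succ _ (k + 1), valA_self, Nat.sub_zero, valB_self, mul_zero, zero_smul,
      zero_smul, add_zero, add_zero]
    congr 2
    · refine Finset.sum_congr rfl fun j _ => ?_
      rw [Nat.add_sub_add_right]
      congr 2
      push_cast
      ring
    · refine Finset.sum_congr rfl fun j _ => ?_
      congr 2
      push_cast
      ring

theorem posRule_succ (h : Generic qh th) {m l : ℕ} (hb : BosRule qh th m l)
    (hn : ∀ k, l = k + 1 → NegRule qh th m k) : PosRule qh th m (l + 1) := by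
  have h1 : elecE qh th ((l + 1 : ℕ) : ℤ) * bosP qh th m
      = T 1 * (bosP qh th l * bosP qh th m)
        - mulXCoeff qh th l • (elecE qh th (1 - (l : ℤ)) * bosP qh th m) := by
    rw [← mul_assoc, T_mul_bosP h, add_mul, smul_mul_assoc, add_sub_cancel_right]
    push_cast
    rfl
  have h2 : ∑ j ∈ Finset.range (l + 1 + 1),
        (valA qh th m (l + 1) j • elecE qh th ((m : ℤ) + (l + 1 : ℕ) - 2 * j)
          + valB qh th m (l + 1) (l + 1 - j) • elecE qh th (-((m : ℤ) + (l + 1 : ℕ) - 2 * j)))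
      = ∑ j ∈ Finset.range (l + 1),
        (valA qh th m (l + 1) j • elecE qh th ((m : ℤ) + l - 2 * j + 1)
          + valB qh th m (l + 1) (l - j) • elecE qh th (1 - ((m : ℤ) + l - 2 * j))) := by
    rw [Finset.sum_add_distrib, Finset.sum_add_distrib, Finset.sum_range_succ _ (l + 1),
      Finset.sum_range_succ' _ (l + 1), valA_self, Nat.sub_zero, valB_self, zero_smul, zero_smul,
      add_zero, add_zero]
    congr 1
    · refine Finset.sum_congr rfl fun j _ => ?_
      congr 2
      push_cast
      ring
    · refine Finset.sum_congr rfl fun j _ => ?_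
      rw [Nat.add_sub_add_right]
      congr 2
      push_cast
      ring
  rw [PosRule, h1, h2, mulXCoeff_smul_elecE_mul m l hn, hb, Finset.mul_sum,
    ← Finset.sum_sub_distrib]
  refine Finset.sum_congr rfl fun j hj => ?_
  obtain ⟨i, rfl⟩ : ∃ i, l = i + j := ⟨l - j, by have := Finset.mem_range.mp hj; omega⟩
  rw [Nat.add_sub_cancel, show (m : ℤ) + (i + j : ℕ) - 2 * j = (m : ℤ) + i - j by push_cast; ring,
    mul_smul_comm]
  exact elecE_succ_term h m i j

/-- Needs its own proof: `PosRule` fails at `l = 0`, since its coefficients vanish there while `P_m`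
does not. -/
theorem negRule_zero (h : Generic qh th) (m : ℕ) : NegRule qh th m 0 := by
  have h1 := valA_succ h m 0 0
  have h2 := valB_succ h (m := m) (i := 0) (j := 0) (n := m) rfl
  simp only [add_zero, zero_add, valC_zero_zero, bosCoeff_eq, mulXCoeff_zero, mul_zero, zero_mul,
    sub_zero, one_mul] at h1 h2
  rw [NegRule, Nat.cast_zero, neg_zero, elecE_zero h, one_mul]
  simp [h1, h2, bosP_eq, bosCoeff_eq, add_comm]

theorem product_rules (h : Generic qh th) (m l : ℕ) :
    BosRule qh th m (l + 1) ∧ PosRule qh th m (l + 1) ∧ NegRule qh th m (l + 1) := by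
  have step : ∀ k, BosRule qh th m k → (∀ n, k = n + 1 → NegRule qh th m n) →
      BosRule qh th m (k + 1) ∧ PosRule qh th m (k + 1) ∧ NegRule qh th m (k + 1) := by
    intro k hb hn
    have hp := posRule_succ h hb hn
    have hb' := bosRule_of_posRule h (Nat.succ_ne_zero k) hp
    exact ⟨hb', hp, negRule_of_bosRule h hb' hp⟩
  induction l using Nat.strong_induction_on with
  | _ l ih =>
    match l with
    | 0 => exact step 0 (bosRule_zero h m) (by omega)
    | 1 =>
      refine step 1 (ih 0 one_pos).1 fun n hn => ?_
      obtain rfl : n = 0 := by omega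
      exact negRule_zero h m
    | l + 2 =>
      refine step (l + 2) (ih (l + 1) (by omega)).1 fun n hn => ?_
      obtain rfl : n = l + 1 := by omega
      exact (ih l (by omega)).2.2

end ProductRules

end

end SL2Macdonald

/-! ### Transfer to rational functions and reindexing -/

open SL2Macdonald in
theorem theorem6p2 {K : Type*} [Field K] (q t qh th : K)
    (hq0 : q ≠ 0) (ht0 : t ≠ 0) (hqh : qh ^ 2 = q) (hth : th ^ 2 = t)
    (hgen : ∀ a b : ℤ, q ^ a * t ^ b = 1 → a = 0 ∧ b = 0)
    (l m : ℕ) (hl : 0 < l) (hm : 0 < m) :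
    -- the electronic Macdonald polynomials are well defined
    (∀ r : ℤ, ∃! f : LaurentPolynomial K, IsElectronic qh th r f) ∧
    -- all coefficients lie in the domain of the evaluation
    (∀ j ≤ l, EvDefined qh th m (coefC q t l j)) ∧
    (∀ j < l, EvDefined qh th m (coefA q t l j) ∧ EvDefined qh th m (coefB q t l j)) ∧
    (∀ j ≤ l, EvDefined qh th m (RatFunc.C t * coefB q t (l + 1) j) ∧
      EvDefined qh th m (coefA q t (l + 1) j)) ∧
    -- the terms of the first product rule with a negative index have coefficient zero
    (∀ j ≤ l, m + l < 2 * j → ev qh th m (coefC q t l j) = 0) ∧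
    -- the product rules
    bosP qh th l * bosP qh th m
      = (∑ j ∈ Finset.range (l + 1),
          ev qh th m (coefC q t l j) • bosP qh th (m + l - 2 * j)) ∧
    elecE qh th l * bosP qh th m
      = (∑ j ∈ Finset.range l,
          ev qh th m (coefA q t l j) • elecE qh th ((m : ℤ) + l - 2 * j))
        + (∑ j ∈ Finset.range l,
          ev qh th m (coefB q t l j) • elecE qh th (-(m : ℤ) + l - 2 * j)) ∧
    elecE qh th (-(l : ℤ)) * bosP qh th m
      = (∑ j ∈ Finset.range (l + 1),
          ev qh th m (RatFunc.C t * coefB q t (l + 1) j) •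
            elecE qh th ((m : ℤ) - ((l : ℤ) - 2 * j)))
        + (∑ j ∈ Finset.range (l + 1),
          ev qh th m (coefA q t (l + 1) j) •
            elecE qh th (-(m : ℤ) - ((l : ℤ) - 2 * j))) := by
  subst hqh hth
  have h : Generic qh th :=
    ⟨fun h0 => hq0 (by simp [h0]), fun h0 => ht0 (by simp [h0]), hgen⟩
  have hreg := regular_evPoint h m
  have hy := evPoint_ne_zero h m
  have hC := fun j => HasEval.coefC hreg hy l j
  have hA := fun j => HasEval.coefA hreg hy hl.ne' j
  have hB := fun j => HasEval.coefB hreg hy hl.ne' j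
  have hA' := fun j => HasEval.coefA hreg hy (Nat.succ_ne_zero l) j
  have hB' := fun j => (HasEval.C (th ^ 2)).mul (HasEval.coefB hreg hy (Nat.succ_ne_zero l) j)
  have eC : ∀ j, ev qh th m (coefC (qh ^ 2) (th ^ 2) l j) = valC qh th m l j :=
    fun j => (hC j).eval_eq
  have eA : ∀ j, ev qh th m (coefA (qh ^ 2) (th ^ 2) l j) = valA qh th m l j :=
    fun j => (hA j).eval_eq
  have eB : ∀ j, ev qh th m (coefB (qh ^ 2) (th ^ 2) l j) = valB qh th m l j :=
    fun j => (hB j).eval_eq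
  have eA' : ∀ j, ev qh th m (coefA (qh ^ 2) (th ^ 2) (l + 1) j) = valA qh th m (l + 1) j :=
    fun j => (hA' j).eval_eq
  have eB' : ∀ j, ev qh th m (RatFunc.C (th ^ 2) * coefB (qh ^ 2) (th ^ 2) (l + 1) j)
      = th ^ 2 * valB qh th m (l + 1) j := fun j => (hB' j).eval_eq
  simp only [eC, eA, eB, eA', eB']
  obtain ⟨h1, h2, h3⟩ : BosRule qh th m l ∧ PosRule qh th m l ∧ NegRule qh th m l := by
    obtain ⟨k, rfl⟩ := Nat.exists_eq_add_one_of_ne_zero hl.ne'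
    exact product_rules h m k
  refine ⟨existsUnique_isElectronic h, fun j _ => (hC j).denom_eval_ne_zero,
    fun j _ => ⟨(hA j).denom_eval_ne_zero, (hB j).denom_eval_ne_zero⟩,
    fun j _ => ⟨(hB' j).denom_eval_ne_zero, (hA' j).denom_eval_ne_zero⟩, fun j hj hmj => ?_,
    h1, ?_, ?_⟩
  · obtain ⟨i, rfl⟩ : ∃ i, l = i + j := ⟨l - j, by omega⟩
    exact valC_eq_zero h (by omega)
  · rw [h2, Finset.sum_add_distrib, Finset.sum_range_succ, valA_self, zero_smul, add_zero]
    congr 1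
    -- In `PosRule` the index of `B` is `l - j`, so the zero term sits at `j = 0`; reversing the
    -- rest gives the stated order.
    rw [Finset.sum_range_succ', Nat.sub_zero, valB_self, zero_smul, add_zero,
      ← Finset.sum_range_reflect]
    refine Finset.sum_congr rfl fun j hj => ?_
    have hj' := Finset.mem_range.mp hj
    rw [show l - (l - 1 - j + 1) = j by omega,
      show -((m : ℤ) + l - 2 * ((l - 1 - j + 1 : ℕ) : ℤ)) = -(m : ℤ) + l - 2 * j by omega]
  · rw [h3, Finset.sum_add_distrib, ← Finset.sum_range_reflect]
    congr 1
    · refine Finset.sum_congr rfl fun j hj => ?_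
      have hj' := Finset.mem_range.mp hj
      rw [Nat.add_sub_cancel, Nat.sub_sub_self (by omega)]
      congr 2
      push_cast [show j ≤ l by omega]
      ring
    · refine Finset.sum_congr rfl fun j _ => ?_
      congr 2
      ring
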